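/- Let $\eta_{ij}=\delta_{i+j,6}$. For $0<\sigma\le\frac12$ consider the Frobenius equation $$(1-\sigma)\alpha_2+\tfrac12\alpha_3+\sigma\alpha_4=2,\qquad \alpha=(\alpha_2,\alpha_3,\alpha_4)\in\mathbb Z_{\ge0}^3 .$$ A pivot point is an $\alpha$ whose monomial $(t^2)^{\alpha_2}(t^3)^{\alpha_3}(t^4)^{\alpha_4}$ has non-zero coefficient in $\big(\sum_{i,j=2}^4\eta_{ij}t^it^j\big)^2=4\big(t^2t^4+\frac12(t^3)^2\big)^2$. (1) The pivot points are $(2,0,2),(1,2,1),(0,4,0)$. The solutions of the Frobenius equation that are not pivot points are exactly the entries of all rows of the following table whose parameter equals $\sigma$ (there are none if no row applies): * $\sigma=\frac12$: $(4,0,0),(3,0,1),(1,0,3),(0,0,4),(3,1,0),(2,1,1),(1,1,2),(0,1,3),(2,2,0),(0,2,2),(1,3,0),(0,3,1)$; * $\sigma=\frac13$: $(3,0,0),(1,0,4),(0,0,6),(0,2,3)$; * $\sigma=\frac14$: $(1,0,5),(0,0,8),(2,1,0),(1,1,3),(0,1,6),(0,2,4),(0,3,2)$; * $\sigma=\frac1n$,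 $n\ge5$ odd: $(1,0,n+1),(0,0,2n),(0,2,n)$; * $\sigma=\frac2{2n+1}$, $n\ge2$: $(0,0,2n+1)$; * $\sigma=\frac1{2n}$, $n\ge2$: $(1,0,2n+1),(0,0,4n),(1,1,n+1),(0,1,3n),(0,2,2n),(0,3,n)$; * $\sigma=\frac3{2n}$, $n\ge4$: $(0,1,n)$. (2) Let $0<\sigma\le\frac12$, let $U\subset\mathbb C$ be open and connected (and non-empty), and let $$F=\tfrac12(t^1)^2t^5+t^1\big(t^2t^4+\tfrac12(t^3)^2\big)+\sum_\alpha g_\alpha(t^5)\,(t^2)^{\alpha_2}(t^3)^{\alpha_3}(t^4)^{\alpha_4}$$ be a finite sum with $g_\alpha$ holomorphic on $U$, such that on $M=\mathbb C^4\times U$ one has $E(F)=2F$, where $E=t^1\partial_1+(1-\sigma)t^2\partial_2+\frac12t^3\partial_3+\sigma t^4\partial_4$, and $F$ satisfies the WDVV equations. Then $g_\alpha=0$ on $U$ unless $\alpha$ is a pivot point or an entry of the table for $\sigma$. If moreover $\sigma\neq\frac12$, then: * there is a pivot term $\gamma$, namely $\gamma=-4g_{(1,2,1)}$ or, possibly if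 $\sigma=\frac14$, $\gamma=4g_{(1,2,1)}-8g_{(2,0,2)}$, with $\gamma'=\frac12\gamma^2$ on $U$; * write $F=\tfrac12(t^1)^2t^5+t^1\big(t^2t^4+\tfrac12(t^3)^2\big)-\frac14\gamma(t^5)\big(t^2t^4+\frac12(t^3)^2\big)^2+\sum_\alpha h_\alpha(t^5)(t^2)^{\alpha_2}(t^3)^{\alpha_3}(t^4)^{\alpha_4}$ and $w_\alpha=\alpha_2+\alpha_3+\alpha_4-2$. Either $\gamma=0$ on $U$ and $h_\alpha''=0$ on $U$ for all $\alpha$, or there is $c\in\mathbb C\setminus U$ such that $\gamma(\tau)=-\frac{2}{\tau-c}$ on $U$ and all $h_\alpha$ satisfy on $U$ the Euler equations $$(\tau-c)^2h_\alpha''+2(w_\alpha+1)(\tau-c)h_\alpha'+w_\alpha(w_\alpha+1)h_\alpha=0;$$ * the Frobenius manifold is nowhere semisimple: for no $t\in M$ does the tangent algebra $(T_tM,\circ)$, with $\partial_i\circ\partial_j=c^k_{ij}\partial_k$, have a basis $e_1,\dots,e_5$ with $e_i\circ e_j=\delta_{ij}e_i$. Hence, if the tangent algebra is semisimple at some point of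 $M$, then $\sigma=\frac12$. -/

import Mathlib

noncomputable section

/-! ### Frobenius manifolds in flat coordinates: WDVV, multiplication, semisimplicity -/

/-- The `i`-th partial derivative of a function of `n` complex variables. -/
def pd {n : ℕ} (i : Fin n) (F : (Fin n → ℂ) → ℂ) : (Fin n → ℂ) → ℂ :=
  fun t => lineDeriv ℂ F t (Pi.single i 1)

/-- The third derivatives `c_{ijk} = ∂³F / ∂t^i ∂t^j ∂t^k`. -/
def cLow {n : ℕ} (F : (Fin n → ℂ) → ℂ) (i j k : Fin n) (t : Fin n → ℂ) : ℂ :=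
  pd i (pd j (pd k F)) t

/-- The Gram matrix `η_{ij} = c_{1ij}`; the first coordinate has index `0` here. -/
def gram {n : ℕ} (F : (Fin (n + 1) → ℂ) → ℂ) (t : Fin (n + 1) → ℂ) :
    Matrix (Fin (n + 1)) (Fin (n + 1)) ℂ :=
  Matrix.of fun i j => cLow F 0 i j t

/-- `F` solves the WDVV equations on `M`: the Gram matrix `c_{1ij}` is constant and
non-degenerate, and
`c_{abl} η^{lm} c_{mdg} = c_{dbl} η^{lm} c_{mag}` (summed over `l` and `m`). -/
structure SolvesWDVV {n : ℕ} (F : (Fin (n + 1) → ℂ) → ℂ) (M : Set (Fin (n + 1) → ℂ)) :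
    Prop where
  metric : ∃ η : Matrix (Fin (n + 1)) (Fin (n + 1)) ℂ, IsUnit η.det ∧ ∀ t ∈ M, gram F t = η
  assoc : ∀ t ∈ M, ∀ a b d g : Fin (n + 1),
    ∑ l, ∑ m, cLow F a b l t * (gram F t)⁻¹ l m * cLow F m d g t =
      ∑ l, ∑ m, cLow F d b l t * (gram F t)⁻¹ l m * cLow F m a g t

/-- The structure constants `c^k_{ij} = η^{kl} c_{lij}`. -/
def cUp {n : ℕ} (F : (Fin (n + 1) → ℂ) → ℂ) (k i j : Fin (n + 1)) (t : Fin (n + 1) → ℂ) : ℂ :=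
  ∑ l, (gram F t)⁻¹ k l * cLow F l i j t

/-- The multiplication `∂_i ∘ ∂_j = c^k_{ij} ∂_k` on the tangent space at `t`. -/
def tangentMul {n : ℕ} (F : (Fin (n + 1) → ℂ) → ℂ) (t v w : Fin (n + 1) → ℂ) :
    Fin (n + 1) → ℂ :=
  fun k => ∑ i, ∑ j, cUp F k i j t * v i * w j

/-- The tangent algebra at `t` is semisimple: there is a basis of vectors `e_i` of the tangent
space with `e_i ∘ e_j = δ_{ij} e_i`. -/
def IsSemisimpleAt {n : ℕ} (F : (Fin (n + 1) → ℂ) → ℂ) (t : Fin (n + 1) → ℂ) : Prop :=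
  ∃ e : Module.Basis (Fin (n + 1)) ℂ (Fin (n + 1) → ℂ),
    ∀ i j, tangentMul F t (e i) (e j) = if i = j then e i else 0

/-! ### The five-dimensional polynomial ansatz
The flat coordinates `t^1, …, t^5` are `t 0, …, t 4`, and a multi-index `(α₂, α₃, α₄)` stands for
the monomial `(t^2)^α₂ (t^3)^α₃ (t^4)^α₄`. -/

/-- The prepotential `½ (t^1)² t^5 + t^1 (t^2 t^4 + ½ (t^3)²) + ∑_α g_α(t^5) (t^2)^α₂ (t^3)^α₃ (t^4)^α₄`
with finitely many coefficient functions `g_α`. -/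
def prepotential (g : (ℕ × ℕ × ℕ) →₀ (ℂ → ℂ)) (t : Fin 5 → ℂ) : ℂ :=
  1 / 2 * t 0 ^ 2 * t 4 + t 0 * (t 1 * t 3 + 1 / 2 * t 2 ^ 2) +
    ∑ α ∈ g.support, g α (t 4) * (t 1 ^ α.1 * t 2 ^ α.2.1 * t 3 ^ α.2.2)

/-- The region of `ℂ⁵` over the domain `U` of the last variable. -/
def regionOver (U : Set ℂ) : Set (Fin 5 → ℂ) := {t | t 4 ∈ U}

/-- The degrees of the Euler field
`E = t^1 ∂_1 + (1 - σ) t^2 ∂_2 + ½ t^3 ∂_3 + σ t^4 ∂_4`. -/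
def eulerDegree (σ : ℝ) : Fin 5 → ℝ := ![1, 1 - σ, 1 / 2, σ, 0]

/-- The derivative of `F` along the Euler field. -/
def eulerDeriv (σ : ℝ) (F : (Fin 5 → ℂ) → ℂ) (t : Fin 5 → ℂ) : ℂ :=
  ∑ i, (eulerDegree σ i : ℂ) * t i * pd i F t

/-! ### The Frobenius equation, pivot points and the table of non-pivot solutions -/

/-- Solutions of the Frobenius equation `(1 - σ) α₂ + ½ α₃ + σ α₄ = 2` in non-negative integers. -/
def frobeniusSolutions (σ : ℝ) : Set (ℕ × ℕ × ℕ) :=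
  {α | (1 - σ) * α.1 + 1 / 2 * α.2.1 + σ * α.2.2 = 2}

/-- The coefficient of `(t^2)^α₂ (t^3)^α₃ (t^4)^α₄` in `(∑_{i,j=2}^4 η_{ij} t^i t^j)²`, where
`η_{ij} = δ_{i+j,6}`; the variables `t^2, t^3, t^4` have indices `0, 1, 2` here. -/
def pivotCoeff (α : ℕ × ℕ × ℕ) : ℂ :=
  MvPolynomial.coeff (Finsupp.equivFunOnFinite.symm ![α.1, α.2.1, α.2.2])
    ((∑ i : Fin 3, ∑ j : Fin 3,
      if (i : ℕ) + (j : ℕ) = 2 then MvPolynomial.X i * MvPolynomial.X j else 0) ^ 2 :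
        MvPolynomial (Fin 3) ℂ)

/-- A multi-index is a pivot point if its coefficient in `(∑ η_{ij} t^i t^j)²` is non-zero. -/
def pivotPoints : Set (ℕ × ℕ × ℕ) := {α | pivotCoeff α ≠ 0}

/-- The entries of the table of non-pivot solutions for the value `σ`: the union of all rows of
the table whose parameter is equal to `σ`. -/
def tableRows (σ : ℝ) : Set (ℕ × ℕ × ℕ) :=
  {α | (σ = 1 / 2 ∧ α ∈ ({(4, 0, 0), (3, 0, 1), (1, 0, 3), (0, 0, 4),
          (3, 1, 0), (2, 1, 1), (1, 1, 2), (0, 1, 3),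
          (2, 2, 0), (0, 2, 2), (1, 3, 0), (0, 3, 1)} : Set (ℕ × ℕ × ℕ))) ∨
       (σ = 1 / 3 ∧ α ∈ ({(3, 0, 0), (1, 0, 4), (0, 0, 6), (0, 2, 3)} : Set (ℕ × ℕ × ℕ))) ∨
       (σ = 1 / 4 ∧ α ∈ ({(1, 0, 5), (0, 0, 8), (2, 1, 0), (1, 1, 3), (0, 1, 6),
          (0, 2, 4), (0, 3, 2)} : Set (ℕ × ℕ × ℕ))) ∨
       (∃ n : ℕ, 5 ≤ n ∧ Odd n ∧ σ = 1 / n ∧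
          α ∈ ({(1, 0, n + 1), (0, 0, 2 * n), (0, 2, n)} : Set (ℕ × ℕ × ℕ))) ∨
       (∃ n : ℕ, 2 ≤ n ∧ σ = 2 / (2 * n + 1) ∧ α = (0, 0, 2 * n + 1)) ∨
       (∃ n : ℕ, 2 ≤ n ∧ σ = 1 / (2 * n) ∧
          α ∈ ({(1, 0, 2 * n + 1), (0, 0, 4 * n), (1, 1, n + 1), (0, 1, 3 * n),
            (0, 2, 2 * n), (0, 3, n)} : Set (ℕ × ℕ × ℕ))) ∨
       (∃ n : ℕ, 4 ≤ n ∧ σ = 3 / (2 * n) ∧ α = (0, 1, n))}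

/-! ### The reduced equations -/

/-- The coefficient functions that remain after the term `-¼ γ(t^5) (t^2 t^4 + ½ (t^3)²)²` has been
split off; note that `(t^2 t^4 + ½ (t^3)²)² = ¼ (∑ η_{ij} t^i t^j)²`. -/
def remainder (g : (ℕ × ℕ × ℕ) →₀ (ℂ → ℂ)) (γ : ℂ → ℂ) (α : ℕ × ℕ × ℕ) : ℂ → ℂ :=
  fun τ => g α τ + 1 / 16 * pivotCoeff α * γ τ

/-- The modular weight `α₂ + α₃ + α₄ - 2` of the coefficient function with index `α`. -/
def weight (α : ℕ × ℕ × ℕ) : ℂ := (α.1 : ℂ) + α.2.1 + α.2.2 - 2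

/-- The second order Euler equation `(τ - c)² h'' + p (τ - c) h' + q h = 0` on `U`. -/
def EulerEquation (c p q : ℂ) (h : ℂ → ℂ) (U : Set ℂ) : Prop :=
  ∀ τ ∈ U, (τ - c) ^ 2 * deriv (deriv h) τ + p * (τ - c) * deriv h τ + q * h τ = 0

end

/-! Write `x, y, z, τ` for `t^2, t^3, t^4, t^5`. Comparing monomials of `E(F) = 2F` at `t^1 = 0`
leaves only coefficients whose index solves the Frobenius equation. For `σ < 1/2` that equation
confines the non-cubic part to `k₃ x³ + k₂ x² y + a x² z² + b x y² z + c y⁴ + x p + x y q + r + y s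
+ y² u + y³ v` with polynomials `p, …, v` in `z`. Six of the WDVV equations, expanded in `x` and
`y`, become relations between these coefficients and their first `τ`-derivatives (`ReducedWDVV`).

The term `x³` needs `σ = 1/3` and `x² y` needs `σ = 1/4`, so there are three eliminations:
`reducedWDVV_third`, `reducedWDVV_quarter` and `reducedWDVV_generic`. Each yields `γ' = γ²/2`, with
`γ = -4b` or, for `σ = 1/4`, `γ = 4b - 8a`. Each remainder `h` of weight `w` then satisfies `h' =
(w/2) γ h`, except that pure powers of `z` carry a forcing term `κ` quadratic in other coefficients,
with `κ' = ((w+2)/2) γ κ`. One more differentiation eliminates `κ` and gives `ModularEquation` in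
all cases. The Riccati solutions `γ = 0` and `γ = -2/(τ-c)` turn it into `h'' = 0` and the Euler
equation.

For non-semisimplicity, note that the Euler solutions are spanned by `(τ-c)^(-w)` and
`(τ-c)^(-w-1)`: after inversion of the last coordinate the potential should be affine in it, apart
from the universal cubic terms, so that the new last coordinate field has square zero. In the old
coordinates this field is, up to a factor, `∂_5 - (γ/2)(x∂_x + y∂_y + z∂_z) - (γ²/4)(xz + y²/2)
∂_1`. The proof checks directly that this non-zero vector squares to zero, for every `γ` at once;
for `γ = 0` it is `∂_5`. A semisimple algebra has no such vector. -/

noncomputable section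

/-! ### Derivatives of the prepotential -/

/-- The sum `∑_{α ∈ S} g_α^{(n)}(t^5) ∂_2^i ∂_3^j ∂_4^k ((t^2)^α₂ (t^3)^α₃ (t^4)^α₄)`. -/
def jetSum (S : Finset (ℕ × ℕ × ℕ)) (g : ℕ × ℕ × ℕ → ℂ → ℂ) (i j k n : ℕ) (t : Fin 5 → ℂ) : ℂ :=
  ∑ α ∈ S, deriv^[n] (g α) (t 4) *
    ((α.1.descFactorial i * t 1 ^ (α.1 - i)) * (α.2.1.descFactorial j * t 2 ^ (α.2.1 - j)) *
      (α.2.2.descFactorial k * t 3 ^ (α.2.2 - k)))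

/-- The partial derivative with multi-index `d` of the polynomial part of the prepotential. -/
def jet (S : Finset (ℕ × ℕ × ℕ)) (g : ℕ × ℕ × ℕ → ℂ → ℂ) (d : Fin 5 → ℕ) (t : Fin 5 → ℂ) : ℂ :=
  if d 0 = 0 then jetSum S g (d 1) (d 2) (d 3) (d 4) t else 0

/-- The cubic part of the prepotential. -/
def cubic (t : Fin 5 → ℂ) : ℂ :=
  1 / 2 * t 0 ^ 2 * t 4 + t 0 * (t 1 * t 3 + 1 / 2 * t 2 ^ 2)

/-- First derivatives of the cubic part. -/
def cubicGrad (i : Fin 5) (t : Fin 5 → ℂ) : ℂ :=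
  ![t 0 * t 4 + t 1 * t 3 + 1 / 2 * t 2 ^ 2, t 0 * t 3, t 0 * t 2, t 0 * t 1, 1 / 2 * t 0 ^ 2] i

/-- Second derivatives of the cubic part. -/
def cubicHess (i j : Fin 5) (t : Fin 5 → ℂ) : ℂ :=
  ![![t 4, t 3, t 2, t 1, t 0], ![t 3, 0, 0, t 0, 0], ![t 2, 0, t 0, 0, 0], ![t 1, t 0, 0, 0, 0],
    ![t 0, 0, 0, 0, 0]] i j

/-- Third derivatives of the cubic part. -/
def cubicThird (i j k : Fin 5) : ℂ :=
  if (i : ℕ) + j + k = 4 ∧ (i = 0 ∨ j = 0 ∨ k = 0) then 1 else 0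

lemma hasLineDerivAt_coord (m i : Fin 5) (t : Fin 5 → ℂ) :
    HasLineDerivAt ℂ (fun t : Fin 5 → ℂ => t m) (if m = i then 1 else 0) t (Pi.single i 1) := by
  unfold HasLineDerivAt
  simp only [Pi.add_apply, Pi.smul_apply, Pi.single_apply, smul_eq_mul]
  exact ((hasDerivAt_id (0 : ℂ)).mul_const _).const_add (t m) |>.congr_deriv (by simp)

lemma hasLineDerivAt_of_coords {f : (Fin 5 → ℂ) → ℂ} {f' : ℂ} {i : Fin 5} {t : Fin 5 → ℂ}
    (h : HasDerivAt (fun s => f (Function.update t i (t i + s))) f' 0) :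
    HasLineDerivAt ℂ f f' t (Pi.single i 1) := by
  have : ∀ s : ℂ, t + s • Pi.single i 1 = Function.update t i (t i + s) := fun s => by
    ext m
    by_cases hm : m = i
    · subst hm; simp
    · simp [hm]
  simpa only [HasLineDerivAt, this] using h

lemma hasDerivAt_add_pow_zero (x : ℂ) (n : ℕ) :
    HasDerivAt (fun s => (x + s) ^ n) (n * x ^ (n - 1)) 0 := by
  refine (((hasDerivAt_id (0 : ℂ)).const_add x).pow n).congr_deriv (by simp)

lemma hasLineDerivAt_cubic (i : Fin 5) (t : Fin 5 → ℂ) :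
    HasLineDerivAt ℂ cubic (cubicGrad i t) t (Pi.single i 1) := by
  have c := fun m => hasLineDerivAt_coord m i t
  have := ((((c 0).pow 2).const_mul (1 / 2)).mul (c 4)).add
    ((c 0).mul (((c 1).mul (c 3)).add (((c 2).pow 2).const_mul (1 / 2))))
  refine HasDerivAt.congr_deriv this ?_
  fin_cases i <;> simp [cubicGrad]
  ring

lemma hasLineDerivAt_cubicGrad (i j : Fin 5) (t : Fin 5 → ℂ) :
    HasLineDerivAt ℂ (cubicGrad j) (cubicHess i j t) t (Pi.single i 1) := by
  have c := fun m => hasLineDerivAt_coord m i t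
  fin_cases j
  · refine HasDerivAt.congr_deriv ((((c 0).mul (c 4)).add ((c 1).mul (c 3))).add
      (((c 2).pow 2).const_mul (1 / 2))) ?_
    fin_cases i <;> simp [cubicHess]
  · refine HasDerivAt.congr_deriv ((c 0).mul (c 3)) ?_
    fin_cases i <;> simp [cubicHess]
  · refine HasDerivAt.congr_deriv ((c 0).mul (c 2)) ?_
    fin_cases i <;> simp [cubicHess]
  · refine HasDerivAt.congr_deriv ((c 0).mul (c 1)) ?_
    fin_cases i <;> simp [cubicHess]
  · refine HasDerivAt.congr_deriv (((c 0).pow 2).const_mul (1 / 2)) ?_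
    fin_cases i <;> simp [cubicHess]

lemma hasLineDerivAt_cubicHess (i j k : Fin 5) (t : Fin 5 → ℂ) :
    HasLineDerivAt ℂ (cubicHess j k) (cubicThird i j k) t (Pi.single i 1) := by
  have c := fun m => hasLineDerivAt_coord m i t
  have z : HasLineDerivAt ℂ (fun _ : Fin 5 → ℂ => (0 : ℂ)) 0 t (Pi.single i 1) :=
    hasDerivAt_const _ _
  fin_cases j <;> fin_cases k <;>
    first
    | (refine HasDerivAt.congr_deriv (c 0) ?_; fin_cases i <;> simp [cubicThird])
    | (refine HasDerivAt.congr_deriv (c 1) ?_; fin_cases i <;> simp [cubicThird])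
    | (refine HasDerivAt.congr_deriv (c 2) ?_; fin_cases i <;> simp [cubicThird])
    | (refine HasDerivAt.congr_deriv (c 3) ?_; fin_cases i <;> simp [cubicThird])
    | (refine HasDerivAt.congr_deriv (c 4) ?_; fin_cases i <;> simp [cubicThird])
    | (refine HasDerivAt.congr_deriv z ?_; fin_cases i <;> simp [cubicThird])

lemma differentiableOn_iterate_deriv {U : Set ℂ} (hU : IsOpen U) {f : ℂ → ℂ}
    (hf : DifferentiableOn ℂ f U) (n : ℕ) : DifferentiableOn ℂ (deriv^[n] f) U := by
  induction n with
  | zero => exact hf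
  | succ n ih => rw [Function.iterate_succ_apply']; exact ih.deriv hU

lemma hasDerivAt_iterate_deriv {U : Set ℂ} (hU : IsOpen U) {f : ℂ → ℂ}
    (hf : DifferentiableOn ℂ f U) (n : ℕ) {τ : ℂ} (hτ : τ ∈ U) :
    HasDerivAt (deriv^[n] f) (deriv^[n + 1] f τ) τ := by
  rw [Function.iterate_succ_apply']
  exact ((differentiableOn_iterate_deriv hU hf n).differentiableAt (hU.mem_nhds hτ)).hasDerivAt

lemma hasDerivAt_descFactorial_mul_pow (x : ℂ) (a i : ℕ) :
    HasDerivAt (fun s => (a.descFactorial i : ℂ) * (x + s) ^ (a - i))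
      (a.descFactorial (i + 1) * x ^ (a - (i + 1))) 0 := by
  refine ((hasDerivAt_add_pow_zero x (a - i)).const_mul _).congr_deriv ?_
  rw [Nat.descFactorial_succ, Nat.cast_mul, Nat.sub_sub]; ring

/-- Each differentiation raises one entry of the multi-index. The factor `descFactorial` vanishes
once the order exceeds the exponent, so the truncated subtraction in the powers is harmless. -/
lemma hasLineDerivAt_jet {U : Set ℂ} (hU : IsOpen U) (S : Finset (ℕ × ℕ × ℕ))
    {g : ℕ × ℕ × ℕ → ℂ → ℂ} (hg : ∀ α, DifferentiableOn ℂ (g α) U) (d : Fin 5 → ℕ) (i : Fin 5)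
    {t : Fin 5 → ℂ} (ht : t ∈ regionOver U) :
    HasLineDerivAt ℂ (jet S g d) (jet S g (d + Pi.single i 1) t) t (Pi.single i 1) := by
  unfold jet
  by_cases h0 : d 0 = 0
  swap
  · simp only [h0, Pi.add_apply, if_false]
    rw [if_neg (by omega)]
    exact hasDerivAt_const _ _
  simp only [h0, if_true]
  apply hasLineDerivAt_of_coords
  unfold jetSum
  fin_cases i
  · simpa [h0, Function.update_of_ne] using hasDerivAt_const _ _
  · simp only [Fin.mk_one, Pi.add_apply, Pi.single_apply, h0, if_true]
    simp only [Fin.isValue, Fin.reduceEq, if_false, if_true, add_zero]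
    refine HasDerivAt.fun_sum fun α _ => ?_
    simp only [Function.update_self, ne_eq, Fin.reduceEq, not_false_eq_true, Function.update_of_ne]
    exact (((hasDerivAt_descFactorial_mul_pow _ _ _).mul_const _).mul_const _).const_mul _
  · simp only [Fin.reduceFinMk, Pi.add_apply, Pi.single_apply, h0, if_true]
    simp only [Fin.isValue, Fin.reduceEq, if_false, if_true, add_zero]
    refine HasDerivAt.fun_sum fun α _ => ?_
    simp only [Function.update_self, ne_eq, Fin.reduceEq, not_false_eq_true, Function.update_of_ne]
    exact (((hasDerivAt_descFactorial_mul_pow _ _ _).const_mul _).mul_const _).const_mul _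
  · simp only [Fin.reduceFinMk, Pi.add_apply, Pi.single_apply, h0, if_true]
    simp only [Fin.isValue, Fin.reduceEq, if_false, if_true, add_zero]
    refine HasDerivAt.fun_sum fun α _ => ?_
    simp only [Function.update_self, ne_eq, Fin.reduceEq, not_false_eq_true, Function.update_of_ne]
    exact ((hasDerivAt_descFactorial_mul_pow _ _ _).const_mul _).const_mul _
  · simp only [Fin.reduceFinMk, Pi.add_apply, Pi.single_apply, h0, if_true]
    simp only [Fin.isValue, Fin.reduceEq, if_false, if_true, add_zero]
    refine HasDerivAt.fun_sum fun α _ => ?_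
    simp only [Function.update_self, ne_eq, Fin.reduceEq, not_false_eq_true, Function.update_of_ne]
    refine HasDerivAt.mul_const ?_ _
    have h1 := hasDerivAt_iterate_deriv hU (hg α) (d 4) ht
    exact HasDerivAt.comp_const_add (f := deriv^[d 4] (g α)) (t 4) 0 (by simpa using h1)

lemma isOpen_regionOver {U : Set ℂ} (hU : IsOpen U) : IsOpen (regionOver U) :=
  hU.preimage (continuous_apply 4)

lemma pd_congr {M : Set (Fin 5 → ℂ)} (hM : IsOpen M) {F G : (Fin 5 → ℂ) → ℂ}
    (h : ∀ t ∈ M, F t = G t) (i : Fin 5) {t : Fin 5 → ℂ} (ht : t ∈ M) : pd i F t = pd i G t := by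
  unfold pd
  exact Filter.EventuallyEq.lineDeriv_eq (Filter.eventuallyEq_of_mem (hM.mem_nhds ht) h)

/-- The index set may be enlarged: to a box in the analysis of WDVV, and by the pivot points in the
proof of non-semisimplicity. -/
lemma prepotential_eq (g : (ℕ × ℕ × ℕ) →₀ (ℂ → ℂ)) {S : Finset (ℕ × ℕ × ℕ)}
    (hS : g.support ⊆ S) (t : Fin 5 → ℂ) :
    prepotential g t = cubic t + jet S g 0 t := by
  simp only [prepotential, cubic, jet, jetSum, Pi.zero_apply, if_true, Function.iterate_zero, id,
    Nat.descFactorial_zero, Nat.cast_one, one_mul, Nat.sub_zero]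
  congr 1
  refine Finset.sum_subset hS fun α _ hα => ?_
  simp [Finsupp.notMem_support_iff.mp hα]

section
variable {U : Set ℂ} (hU : IsOpen U) {g : (ℕ × ℕ × ℕ) →₀ (ℂ → ℂ)} {S : Finset (ℕ × ℕ × ℕ)}
  (hS : g.support ⊆ S) (hg : ∀ α, DifferentiableOn ℂ (g α) U) {t : Fin 5 → ℂ}
  (ht : t ∈ regionOver U)
include hU hS hg ht

lemma pd_prepotential (i : Fin 5) :
    pd i (prepotential g) t = cubicGrad i t + jet S g (Pi.single i 1) t := by
  have h := (hasLineDerivAt_cubic i t).add (hasLineDerivAt_jet hU S hg 0 i ht)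
  rw [zero_add] at h
  rw [show prepotential g = fun t => cubic t + jet S g 0 t from funext (prepotential_eq g hS)]
  exact HasLineDerivAt.lineDeriv h

lemma pd_pd_prepotential (i j : Fin 5) :
    pd i (pd j (prepotential g)) t =
      cubicHess i j t + jet S g (Pi.single j 1 + Pi.single i 1) t := by
  rw [pd_congr (isOpen_regionOver hU) (fun t ht => pd_prepotential hU hS hg ht j) i ht]
  exact HasLineDerivAt.lineDeriv
    ((hasLineDerivAt_cubicGrad i j t).add (hasLineDerivAt_jet hU S hg _ i ht))

lemma cLow_prepotential (i j k : Fin 5) :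
    cLow (prepotential g) i j k t =
      cubicThird i j k + jet S g (Pi.single k 1 + Pi.single j 1 + Pi.single i 1) t := by
  unfold cLow
  rw [pd_congr (isOpen_regionOver hU) (fun t ht => pd_pd_prepotential hU hS hg ht j k) i ht]
  exact HasLineDerivAt.lineDeriv
    ((hasLineDerivAt_cubicHess i j k t).add (hasLineDerivAt_jet hU S hg _ i ht))

end

end

noncomputable section

/-! ### The WDVV equations for the polynomial part -/

/-- The constant Gram matrix of the prepotential. -/
def antidiag : Matrix (Fin 5) (Fin 5) ℂ := Matrix.of fun i j => if (i : ℕ) + j = 4 then 1 else 0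

lemma antidiag_apply (i j : Fin 5) : antidiag i j = if j = i.rev then 1 else 0 := by
  fin_cases i <;> fin_cases j <;> simp [antidiag, Fin.rev, Fin.ext_iff]

lemma antidiag_inv : antidiag⁻¹ = antidiag := by
  refine Matrix.inv_eq_right_inv ?_
  ext i j
  simp only [Matrix.mul_apply, antidiag_apply, ite_mul, one_mul, zero_mul, Finset.sum_ite_eq',
    Finset.mem_univ, if_true, Fin.rev_rev, Matrix.one_apply]
  simp only [eq_comm]

section
variable {U : Set ℂ} (hU : IsOpen U) {g : (ℕ × ℕ × ℕ) →₀ (ℂ → ℂ)} {S : Finset (ℕ × ℕ × ℕ)}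
  (hS : g.support ⊆ S) (hg : ∀ α, DifferentiableOn ℂ (g α) U) {t : Fin 5 → ℂ}
  (ht : t ∈ regionOver U)
include hU hS hg ht

lemma gram_prepotential : gram (prepotential g) t = antidiag := by
  ext i j
  simp [gram, cLow_prepotential hU hS hg ht, jet, antidiag, cubicThird]

/-- The antidiagonal matrix is its own inverse, so raising an index is `Fin.rev` and the double sum
collapses. -/
lemma assoc_prepotential (hW : SolvesWDVV (prepotential g) (regionOver U)) (a b d e : Fin 5) :
    ∑ l, cLow (prepotential g) a b l t * cLow (prepotential g) l.rev d e t =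
      ∑ l, cLow (prepotential g) d b l t * cLow (prepotential g) l.rev a e t := by
  have h := hW.assoc t ht a b d e
  rw [gram_prepotential hU hS hg ht, antidiag_inv] at h
  simpa [antidiag_apply] using h

lemma tangentMul_prepotential (v w : Fin 5 → ℂ) (k : Fin 5) :
    tangentMul (prepotential g) t v w k =
      ∑ i, ∑ j, cLow (prepotential g) k.rev i j t * v i * w j := by
  simp [tangentMul, cUp, gram_prepotential hU hS hg ht, antidiag_inv, antidiag_apply]

/-- In this and the next five lemmas the name records which two products of coordinate fields are
paired. Derivatives in `τ` enter linearly and only to first order, because they are multiplied by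
the constants `c_{1ij}`. -/
lemma wdvv_xx_zz (hW : SolvesWDVV (prepotential g) (regionOver U)) :
    jetSum S g 3 0 0 0 t * jetSum S g 0 0 3 0 t + jetSum S g 2 1 0 0 t * jetSum S g 0 1 2 0 t
      - jetSum S g 2 0 1 0 t * jetSum S g 1 0 2 0 t - jetSum S g 1 1 1 0 t ^ 2
      = 2 * jetSum S g 1 0 1 1 t := by
  have h := assoc_prepotential hU hS hg ht hW 1 1 3 3
  simp [Fin.sum_univ_five, cLow_prepotential hU hS hg ht, jet, cubicThird, Fin.rev,
    Pi.single_apply] at h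
  linear_combination h

lemma wdvv_xx_yy (hW : SolvesWDVV (prepotential g) (regionOver U)) :
    2 * jetSum S g 2 1 0 0 t * jetSum S g 1 1 1 0 t + jetSum S g 1 2 0 0 t ^ 2
      = jetSum S g 3 0 0 0 t * jetSum S g 0 2 1 0 t + jetSum S g 2 1 0 0 t * jetSum S g 0 3 0 0 t
        + jetSum S g 2 0 1 0 t * jetSum S g 1 2 0 0 t + jetSum S g 2 0 0 1 t := by
  have h := assoc_prepotential hU hS hg ht hW 1 1 2 2
  simp [Fin.sum_univ_five, cLow_prepotential hU hS hg ht, jet, cubicThird, Fin.rev,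
    Pi.single_apply] at h
  linear_combination -h

lemma wdvv_zz_xy (hW : SolvesWDVV (prepotential g) (regionOver U)) :
    jetSum S g 0 1 1 1 t = jetSum S g 0 1 2 0 t * jetSum S g 1 2 0 0 t
      - jetSum S g 2 0 1 0 t * jetSum S g 0 1 2 0 t - jetSum S g 1 1 1 0 t * jetSum S g 0 2 1 0 t
      + jetSum S g 0 0 3 0 t * jetSum S g 2 1 0 0 t := by
  have h := assoc_prepotential hU hS hg ht hW 3 3 1 2
  simp [Fin.sum_univ_five, cLow_prepotential hU hS hg ht, jet, cubicThird, Fin.rev,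
    Pi.single_apply] at h
  linear_combination -h

lemma wdvv_zz_yy (hW : SolvesWDVV (prepotential g) (regionOver U)) :
    jetSum S g 0 0 2 1 t = 2 * jetSum S g 1 1 1 0 t * jetSum S g 0 1 2 0 t
      + jetSum S g 0 2 1 0 t ^ 2 - jetSum S g 1 0 2 0 t * jetSum S g 0 2 1 0 t
      - jetSum S g 0 1 2 0 t * jetSum S g 0 3 0 0 t
      - jetSum S g 0 0 3 0 t * jetSum S g 1 2 0 0 t := by
  have h := assoc_prepotential hU hS hg ht hW 3 3 2 2
  simp [Fin.sum_univ_five, cLow_prepotential hU hS hg ht, jet, cubicThird, Fin.rev,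
    Pi.single_apply] at h
  linear_combination h

lemma wdvv_xz_yy (hW : SolvesWDVV (prepotential g) (regionOver U)) :
    jetSum S g 0 2 0 1 t + jetSum S g 1 0 1 1 t = jetSum S g 2 1 0 0 t * jetSum S g 0 1 2 0 t
      + jetSum S g 1 2 0 0 t * jetSum S g 0 2 1 0 t + jetSum S g 1 1 1 0 t ^ 2
      - jetSum S g 2 0 1 0 t * jetSum S g 0 2 1 0 t - jetSum S g 1 1 1 0 t * jetSum S g 0 3 0 0 t
      - jetSum S g 1 0 2 0 t * jetSum S g 1 2 0 0 t := by
  have h := assoc_prepotential hU hS hg ht hW 2 1 3 2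
  simp [Fin.sum_univ_five, cLow_prepotential hU hS hg ht, jet, cubicThird, Fin.rev,
    Pi.single_apply] at h
  linear_combination -h

lemma wdvv_xx_yz (hW : SolvesWDVV (prepotential g) (regionOver U)) :
    jetSum S g 1 1 0 1 t = jetSum S g 3 0 0 0 t * jetSum S g 0 1 2 0 t
      + jetSum S g 2 1 0 0 t * (jetSum S g 0 2 1 0 t - jetSum S g 1 0 2 0 t)
      - jetSum S g 1 2 0 0 t * jetSum S g 1 1 1 0 t := by
  have h := assoc_prepotential hU hS hg ht hW 1 1 2 3
  simp [Fin.sum_univ_five, cLow_prepotential hU hS hg ht, jet, cubicThird, Fin.rev,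
    Pi.single_apply] at h
  linear_combination -h

end

end

noncomputable section

/-! ### Pivot points and the Frobenius equation -/

lemma pivotCoeff_eq (α : ℕ × ℕ × ℕ) :
    pivotCoeff α = (if α = (2, 0, 2) then 4 else 0) + (if α = (1, 2, 1) then 4 else 0) +
      (if α = (0, 4, 0) then 1 else 0) := by
  have key : ((∑ i : Fin 3, ∑ j : Fin 3,
      if (i : ℕ) + (j : ℕ) = 2 then MvPolynomial.X i * MvPolynomial.X j else 0) ^ 2 :
        MvPolynomial (Fin 3) ℂ) =
      MvPolynomial.monomial (Finsupp.equivFunOnFinite.symm ![2, 0, 2]) 4 +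
      MvPolynomial.monomial (Finsupp.equivFunOnFinite.symm ![1, 2, 1]) 4 +
      MvPolynomial.monomial (Finsupp.equivFunOnFinite.symm ![0, 4, 0]) 1 := by
    simp only [MvPolynomial.monomial_eq, Finsupp.prod_fintype, pow_zero, implies_true]
    simp only [Fin.sum_univ_three, Fin.prod_univ_three]
    simp
    rw [show (MvPolynomial.C 4 : MvPolynomial (Fin 3) ℂ) = 4 from map_ofNat _ 4]
    ring
  have h3 : ∀ a b c : ℕ, (Finsupp.equivFunOnFinite.symm ![a, b, c] : Fin 3 →₀ ℕ) =
      Finsupp.equivFunOnFinite.symm ![α.1, α.2.1, α.2.2] ↔ α = (a, b, c) := by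
    intro a b c
    obtain ⟨x, y, z⟩ := α
    simp [Fin.forall_fin_succ, funext_iff, eq_comm]
  rw [pivotCoeff, key]
  simp only [MvPolynomial.coeff_add, MvPolynomial.coeff_monomial, h3]

lemma pivotPoints_eq : pivotPoints = {(2, 0, 2), (1, 2, 1), (0, 4, 0)} := by
  ext α
  simp only [pivotPoints, Set.mem_ofPred_eq, pivotCoeff_eq, Set.mem_insert_iff,
    Set.mem_singleton_iff]
  by_cases h1 : α = (2, 0, 2)
  · subst h1; simp
  by_cases h2 : α = (1, 2, 1)
  · subst h2; simp
  by_cases h3 : α = (0, 4, 0)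
  · subst h3; simp
  simp [h1, h2, h3]

/-- The shape of the solutions of the Frobenius equation for `σ < 1 / 2`. -/
lemma frobeniusSolutions_cases {σ : ℝ} (h0 : 0 < σ) (h1 : σ < 1 / 2) {α : ℕ × ℕ × ℕ}
    (h : α ∈ frobeniusSolutions σ) :
    (α = (2, 0, 2) ∨ α = (1, 2, 1) ∨ α = (0, 4, 0)) ∨
    (α = (3, 0, 0) ∧ σ = 1 / 3) ∨ (α = (2, 1, 0) ∧ σ = 1 / 4) ∨
    (∃ c : ℕ, 4 ≤ c ∧ α = (1, 0, c) ∧ σ * (c - 1) = 1) ∨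
    (∃ c : ℕ, 3 ≤ c ∧ α = (1, 1, c) ∧ σ * (c - 1) = 1 / 2) ∨
    (∃ c : ℕ, 5 ≤ c ∧ α = (0, 0, c) ∧ σ * c = 2) ∨
    (∃ c : ℕ, 4 ≤ c ∧ α = (0, 1, c) ∧ σ * c = 3 / 2) ∨
    (∃ c : ℕ, 3 ≤ c ∧ α = (0, 2, c) ∧ σ * c = 1) ∨
    (∃ c : ℕ, 2 ≤ c ∧ α = (0, 3, c) ∧ σ * c = 1 / 2) := by
  obtain ⟨a, b, c⟩ := α
  simp only [frobeniusSolutions, Set.mem_ofPred_eq] at h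
  -- As `σ < 1/2`, the relation `σ (c - x) = n/2` forces `c - x > n`. All the lower bounds on `c`
  -- come from this.
  have hlt : ∀ {x : ℝ} {n : ℕ}, 0 < x → σ * (c - x) = n / 2 → 0 < n → (n : ℝ) + x < c := by
    intro x n _ h2 h3
    have h3' : (0 : ℝ) < n := by exact_mod_cast h3
    by_contra h4
    push Not at h4
    nlinarith
  have hlt0 : ∀ {n : ℕ}, σ * c = n / 2 → 0 < n → n < c := by
    intro n h2 h3
    have h3' : (0 : ℝ) < n := by exact_mod_cast h3
    have : (n : ℝ) < c := by
      by_contra h4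
      push Not at h4
      nlinarith
    exact_mod_cast this
  have hc : (0 : ℝ) ≤ σ * c := by positivity
  have ha0 : (0 : ℝ) ≤ (1 - σ) * a := mul_nonneg (by linarith) (by positivity)
  have hb : b ≤ 4 := by
    have : (b : ℝ) ≤ 4 := by linarith
    exact_mod_cast this
  -- Here `1 - σ > 1/2` while `(1 - σ) a ≤ 2`.
  have ha : a < 4 := by
    have : (a : ℝ) < 4 := by
      by_contra h4
      push Not at h4
      nlinarith
    exact_mod_cast this
  simp only [Prod.mk.injEq]
  interval_cases a <;> interval_cases b <;> norm_num at h ⊢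
  · exact ⟨c, hlt0 (n := 4) (by push_cast; linarith) (by norm_num), rfl, by linarith⟩
  · exact ⟨c, hlt0 (n := 3) (by push_cast; linarith) (by norm_num), rfl, by linarith⟩
  · exact ⟨c, hlt0 (n := 2) (by push_cast; linarith) (by norm_num), rfl, by linarith⟩
  · exact ⟨c, hlt0 (n := 1) (by push_cast; linarith) (by norm_num), rfl, by linarith⟩
  · exact h.resolve_left h0.ne'
  · have := hlt (x := 1) (n := 2) one_pos (by push_cast; linarith) (by norm_num)
    norm_num at this
    exact ⟨c, by exact_mod_cast this, rfl, by linarith⟩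
  · have := hlt (x := 1) (n := 1) one_pos (by push_cast; linarith) (by norm_num)
    norm_num at this
    exact ⟨c, by exact_mod_cast this, rfl, by linarith⟩
  · have : σ * (c - 1) = 0 := by linarith
    rcases mul_eq_zero.mp this with h | h
    · linarith
    · have : (c : ℝ) = 1 := by linarith
      exact_mod_cast this
  · nlinarith
  · nlinarith
  · have : σ * (c - 2) = 0 := by linarith
    rcases mul_eq_zero.mp this with h | h
    · linarith
    · have : (c : ℝ) = 2 := by linarith
      exact_mod_cast this
  · rcases c with _ | _ | c
    · push_cast at h; exact ⟨rfl, by linarith⟩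
    · push_cast at h; linarith
    · push_cast at h; nlinarith
  · nlinarith
  · nlinarith
  · nlinarith
  · rcases c with _ | _ | _ | c
    · push_cast at h; exact ⟨rfl, by linarith⟩
    · push_cast at h; linarith
    · push_cast at h; linarith
    · push_cast at h; nlinarith
  · nlinarith
  · nlinarith
  · nlinarith
  · nlinarith

lemma frobeniusSolutions_half {α : ℕ × ℕ × ℕ} :
    α ∈ frobeniusSolutions (1 / 2) ↔ α.1 + α.2.1 + α.2.2 = 4 := by
  simp only [frobeniusSolutions, Set.mem_ofPred_eq]
  rw [← @Nat.cast_inj ℝ]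
  push_cast
  constructor <;> intro h <;> linarith

lemma tableRows_subset {σ : ℝ} : tableRows σ ⊆ frobeniusSolutions σ \ pivotPoints := by
  rw [pivotPoints_eq]
  rintro α h
  rcases h with ⟨rfl, h⟩ | ⟨rfl, h⟩ | ⟨rfl, h⟩ | ⟨n, hn, -, rfl, h⟩ | ⟨n, hn, rfl, h⟩ |
      ⟨n, hn, rfl, h⟩ | ⟨n, hn, rfl, h⟩
  · simp only [Set.mem_insert_iff, Set.mem_singleton_iff] at h
    rcases h with h | h | h | h | h | h | h | h | h | h | h | h <;> subst h <;>
      norm_num [frobeniusSolutions]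
  · simp only [Set.mem_insert_iff, Set.mem_singleton_iff] at h
    rcases h with h | h | h | h <;> subst h <;> norm_num [frobeniusSolutions]
  · simp only [Set.mem_insert_iff, Set.mem_singleton_iff] at h
    rcases h with h | h | h | h | h | h | h <;> subst h <;> norm_num [frobeniusSolutions]
  · have hn0 : (n : ℝ) ≠ 0 := by positivity
    simp only [Set.mem_insert_iff, Set.mem_singleton_iff] at h
    rcases h with h | h | h <;> subst h <;>
      (simp [frobeniusSolutions]; field_simp; try ring)
  · have hn0 : (2 * n + 1 : ℝ) ≠ 0 := by positivity
    subst h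
    simp [frobeniusSolutions]
    field_simp
  · have hn0 : (n : ℝ) ≠ 0 := by positivity
    simp only [Set.mem_insert_iff, Set.mem_singleton_iff] at h
    rcases h with h | h | h | h | h | h <;> subst h <;>
      (simp [frobeniusSolutions]; try (field_simp; ring))
  · have hn0 : (n : ℝ) ≠ 0 := by positivity
    subst h
    simp [frobeniusSolutions]
    field_simp
    ring

lemma mem_tableRows_half {α : ℕ × ℕ × ℕ} (h : α.1 + α.2.1 + α.2.2 = 4) (hp : α ∉ pivotPoints) :
    α ∈ tableRows (1 / 2) := by
  left
  refine ⟨rfl, ?_⟩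
  rw [pivotPoints_eq] at hp
  obtain ⟨a, b, c⟩ := α
  simp only at h
  obtain rfl : c = 4 - a - b := by omega
  have ha : a ≤ 4 := by omega
  have hb : b ≤ 4 - a := by omega
  interval_cases a <;> interval_cases b <;> simp_all

lemma eq_div_of_mul_nat {σ x : ℝ} {n : ℕ} (hn : 0 < n) (h : σ * n = x) : σ = x / n := by
  rw [eq_div_iff (by positivity), h]

/-- Each family of solutions determines `σ` from its last exponent; the row is then found by parity,
with the odd value `n = 3` sent to the row `1/3`. -/
lemma mem_tableRows_of_lt {σ : ℝ} (h0 : 0 < σ) (h1 : σ < 1 / 2) {α : ℕ × ℕ × ℕ}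
    (h : α ∈ frobeniusSolutions σ) (hp : α ∉ pivotPoints) : α ∈ tableRows σ := by
  rw [pivotPoints_eq] at hp
  simp only [Set.mem_insert_iff, Set.mem_singleton_iff] at hp
  rcases frobeniusSolutions_cases h0 h1 h with h | ⟨rfl, hσ⟩ | ⟨rfl, hσ⟩ | ⟨c, hc, rfl, hσ⟩ |
      ⟨c, hc, rfl, hσ⟩ | ⟨c, hc, rfl, hσ⟩ | ⟨c, hc, rfl, hσ⟩ | ⟨c, hc, rfl, hσ⟩ | ⟨c, hc, rfl, hσ⟩
  · exact absurd h hp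
  · exact Or.inr (Or.inl ⟨hσ, by simp⟩)
  -- The row `σ = 1/4` is needed only for `(2, 1, 0)`: its other entries also lie in the row
  -- `1/(2n)` with `n = 2`.
  · exact Or.inr (Or.inr (Or.inl ⟨hσ, by simp⟩))
  · obtain ⟨n, rfl⟩ : ∃ n, c = n + 1 := ⟨c - 1, by omega⟩
    have hσ' : σ = 1 / n := eq_div_of_mul_nat (by omega) (by push_cast at hσ; linarith)
    rcases Nat.even_or_odd' n with ⟨m, rfl | rfl⟩
    · refine Or.inr (Or.inr (Or.inr (Or.inr (Or.inr (Or.inl ⟨m, by omega, ?_, by simp⟩)))))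
      rw [hσ']; push_cast; rfl
    · by_cases h3 : m = 1
      · subst h3
        exact Or.inr (Or.inl ⟨by rw [hσ']; norm_num, by simp⟩)
      · exact Or.inr (Or.inr (Or.inr (Or.inl ⟨2 * m + 1, by omega, ⟨m, rfl⟩, hσ', by simp⟩)))
  · obtain ⟨n, rfl⟩ : ∃ n, c = n + 1 := ⟨c - 1, by omega⟩
    have hσ' : σ = 1 / 2 / n := eq_div_of_mul_nat (by omega) (by push_cast at hσ; linarith)
    refine Or.inr (Or.inr (Or.inr (Or.inr (Or.inr (Or.inl ⟨n, by omega, ?_, by simp⟩)))))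
    rw [hσ', div_div]
  · have hσ' : σ = 2 / c := eq_div_of_mul_nat (by omega) hσ
    rcases Nat.even_or_odd' c with ⟨n, rfl | rfl⟩
    · have hσ'' : σ = 1 / n := by rw [hσ']; push_cast; field_simp
      rcases Nat.even_or_odd' n with ⟨m, rfl | rfl⟩
      · refine Or.inr (Or.inr (Or.inr (Or.inr (Or.inr (Or.inl ⟨m, by omega, ?_, ?_⟩)))))
        · rw [hσ'']; push_cast; rfl
        · simp; omega
      · by_cases h3 : m = 1
        · subst h3
          exact Or.inr (Or.inl ⟨by rw [hσ'']; norm_num, by simp⟩)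
        · exact Or.inr (Or.inr (Or.inr (Or.inl ⟨2 * m + 1, by omega, ⟨m, rfl⟩, hσ'', by simp⟩)))
    · refine Or.inr (Or.inr (Or.inr (Or.inr (Or.inl ⟨n, by omega, ?_, rfl⟩))))
      rw [hσ']; push_cast; rfl
  · by_cases h3 : ∃ n, c = 3 * n
    · obtain ⟨n, rfl⟩ := h3
      refine Or.inr (Or.inr (Or.inr (Or.inr (Or.inr (Or.inl ⟨n, by omega, ?_, by simp⟩)))))
      have hσ' : σ = 1 / 2 / n := eq_div_of_mul_nat (by omega) (by push_cast at hσ; linarith)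
      rw [hσ', div_div]
    · refine Or.inr (Or.inr (Or.inr (Or.inr (Or.inr (Or.inr ⟨c, by omega, ?_, rfl⟩)))))
      have hσ' : σ = 3 / 2 / c := eq_div_of_mul_nat (by omega) hσ
      rw [hσ', div_div]
  · have hσ' : σ = 1 / c := eq_div_of_mul_nat (by omega) hσ
    rcases Nat.even_or_odd' c with ⟨m, rfl | rfl⟩
    · refine Or.inr (Or.inr (Or.inr (Or.inr (Or.inr (Or.inl ⟨m, by omega, ?_, by simp⟩)))))
      rw [hσ']; push_cast; rfl
    · by_cases h3 : m = 1
      · subst h3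
        exact Or.inr (Or.inl ⟨by rw [hσ']; norm_num, by simp⟩)
      · exact Or.inr (Or.inr (Or.inr (Or.inl ⟨2 * m + 1, by omega, ⟨m, rfl⟩, hσ', by simp⟩)))
  · have hσ' : σ = 1 / 2 / c := eq_div_of_mul_nat (by omega) hσ
    refine Or.inr (Or.inr (Or.inr (Or.inr (Or.inr (Or.inl ⟨c, hc, ?_, by simp⟩)))))
    rw [hσ', div_div]

theorem frobeniusSolutions_diff_pivotPoints {σ : ℝ} (h0 : 0 < σ) (h1 : σ ≤ 1 / 2) :
    frobeniusSolutions σ \ pivotPoints = tableRows σ := by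
  refine Set.Subset.antisymm ?_ tableRows_subset
  rintro α ⟨h, hp⟩
  rcases h1.lt_or_eq with h1 | rfl
  · exact mem_tableRows_of_lt h0 h1 h hp
  · exact mem_tableRows_half (frobeniusSolutions_half.mp h) hp

end

noncomputable section

/-! ### The Riccati equation `γ' = γ² / 2` -/

/-- On a ball, `γ` solves the linear equation `γ' = (γ/2) γ`. With a primitive `Γ` of `γ`, the
product `γ exp(-Γ/2)` is constant, hence zero. -/
lemma riccati_eventually_zero {U : Set ℂ} (hU : IsOpen U) {γ : ℂ → ℂ}
    (hγ : ∀ τ ∈ U, HasDerivAt γ (1 / 2 * γ τ ^ 2) τ) {τ₀ : ℂ} (h0 : τ₀ ∈ U) (hz : γ τ₀ = 0) :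
    ∀ᶠ τ in nhds τ₀, γ τ = 0 := by
  obtain ⟨r, hr, hb⟩ := Metric.isOpen_iff.mp hU τ₀ h0
  have hd : DifferentiableOn ℂ γ (Metric.ball τ₀ r) := fun τ hτ =>
    (hγ τ (hb hτ)).differentiableAt.differentiableWithinAt
  obtain ⟨Γ, hΓ⟩ := hd.isExactOn_ball
  have hder : ∀ τ ∈ Metric.ball τ₀ r,
      HasDerivAt (fun τ => γ τ * Complex.exp (-(1 / 2) * Γ τ)) 0 τ := fun τ hτ => by
    refine ((hγ τ (hb hτ)).mul ((hΓ τ hτ).const_mul (-(1 / 2))).cexp).congr_deriv ?_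
    ring
  have hconst : ∀ τ ∈ Metric.ball τ₀ r, γ τ * Complex.exp (-(1 / 2) * Γ τ) =
      γ τ₀ * Complex.exp (-(1 / 2) * Γ τ₀) := fun τ hτ =>
    Metric.isOpen_ball.is_const_of_deriv_eq_zero (convex_ball τ₀ r).isPreconnected
      (fun x hx => (hder x hx).differentiableAt.differentiableWithinAt)
      (fun x hx => (hder x hx).deriv) hτ (Metric.mem_ball_self hr)
  filter_upwards [Metric.ball_mem_nhds τ₀ hr] with τ hτ
  have := hconst τ hτ
  rw [hz, zero_mul] at this
  exact (mul_eq_zero.mp this).resolve_right (Complex.exp_ne_zero _)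

/-- One zero spreads over `U` by the identity theorem. Without zeros, `1/γ + τ/2` has zero
derivative and is constant on `U`. -/
lemma riccati_cases {U : Set ℂ} (hU : IsOpen U) (hc : IsConnected U) {γ : ℂ → ℂ}
    (hγ : ∀ τ ∈ U, HasDerivAt γ (1 / 2 * γ τ ^ 2) τ) :
    (∀ τ ∈ U, γ τ = 0) ∨ ∃ c : ℂ, c ∉ U ∧ ∀ τ ∈ U, γ τ = -2 / (τ - c) := by
  by_cases hz : ∃ τ₀ ∈ U, γ τ₀ = 0
  · obtain ⟨τ₀, h0, hz⟩ := hz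
    left
    have han : AnalyticOnNhd ℂ γ U := DifferentiableOn.analyticOnNhd
      (fun τ hτ => (hγ τ hτ).differentiableAt.differentiableWithinAt) hU
    exact fun τ hτ => han.eqOn_zero_of_preconnected_of_eventuallyEq_zero hc.isPreconnected h0
      (riccati_eventually_zero hU hγ h0 hz) hτ
  · push Not at hz
    right
    obtain ⟨τ₀, h0⟩ := hc.nonempty
    have hder : ∀ τ ∈ U, HasDerivAt (fun τ => (γ τ)⁻¹ + 1 / 2 * τ) 0 τ := fun τ hτ => by
      refine (((hγ τ hτ).inv (hz τ hτ)).add ((hasDerivAt_id τ).const_mul (1 / 2))).congr_deriv ?_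
      have := hz τ hτ
      field_simp
      ring
    have hconst : ∀ τ ∈ U, (γ τ)⁻¹ + 1 / 2 * τ = (γ τ₀)⁻¹ + 1 / 2 * τ₀ := fun τ hτ =>
      hU.is_const_of_deriv_eq_zero hc.isPreconnected
        (fun x hx => (hder x hx).differentiableAt.differentiableWithinAt)
        (fun x hx => (hder x hx).deriv) hτ h0
    set c : ℂ := 2 * ((γ τ₀)⁻¹ + 1 / 2 * τ₀) with hcdef
    have hinv : ∀ τ ∈ U, (γ τ)⁻¹ = (τ - c) / (-2) := fun τ hτ => by
      linear_combination hconst τ hτ - 1 / 2 * hcdef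
    refine ⟨c, fun hcU => ?_, fun τ hτ => ?_⟩
    -- At `τ = c` the formula would give `(γ c)⁻¹ = 0`, hence `γ c = 0`, which is excluded.
    · have := hinv c hcU
      rw [sub_self, zero_div, inv_eq_zero] at this
      exact hz c hcU this
    · rw [← inv_inv (γ τ), hinv τ hτ, inv_div]

/-! ### Quasi-homogeneity -/

lemma mul_descFactorial_succ_pow (x : ℂ) (a i : ℕ) :
    x * (a.descFactorial (i + 1) * x ^ (a - (i + 1))) =
      ((a : ℂ) - i) * (a.descFactorial i * x ^ (a - i)) := by
  rcases lt_trichotomy a i with h | rfl | h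
  · simp [Nat.descFactorial_of_lt h]
  · simp
  · obtain ⟨m, rfl⟩ : ∃ m, a = i + 1 + m := ⟨a - (i + 1), by omega⟩
    rw [Nat.descFactorial_succ, show i + 1 + m - (i + 1) = m by omega,
      show i + 1 + m - i = m + 1 by omega]
    push_cast
    ring

section
variable (S : Finset (ℕ × ℕ × ℕ)) (g : ℕ × ℕ × ℕ → ℂ → ℂ) (i j k n : ℕ) (t : Fin 5 → ℂ)

/-- The summand of `jetSum` without its coefficient. -/
def monoJet (i j k : ℕ) (t : Fin 5 → ℂ) (α : ℕ × ℕ × ℕ) : ℂ :=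
  (α.1.descFactorial i * t 1 ^ (α.1 - i)) * (α.2.1.descFactorial j * t 2 ^ (α.2.1 - j)) *
    (α.2.2.descFactorial k * t 3 ^ (α.2.2 - k))

lemma jetSum_eq_sum :
    jetSum S g i j k n t = ∑ α ∈ S, deriv^[n] (g α) (t 4) * monoJet i j k t α := rfl

lemma mul_jetSum_one :
    t 1 * jetSum S g (i + 1) j k n t =
      ∑ α ∈ S, ((α.1 : ℂ) - i) * (deriv^[n] (g α) (t 4) * monoJet i j k t α) := by
  rw [jetSum_eq_sum, Finset.mul_sum]
  refine Finset.sum_congr rfl fun α _ => ?_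
  unfold monoJet
  linear_combination deriv^[n] (g α) (t 4) * (α.2.1.descFactorial j * t 2 ^ (α.2.1 - j)) *
    (α.2.2.descFactorial k * t 3 ^ (α.2.2 - k)) * mul_descFactorial_succ_pow (t 1) α.1 i

lemma mul_jetSum_two :
    t 2 * jetSum S g i (j + 1) k n t =
      ∑ α ∈ S, ((α.2.1 : ℂ) - j) * (deriv^[n] (g α) (t 4) * monoJet i j k t α) := by
  rw [jetSum_eq_sum, Finset.mul_sum]
  refine Finset.sum_congr rfl fun α _ => ?_
  unfold monoJet
  linear_combination deriv^[n] (g α) (t 4) * (α.1.descFactorial i * t 1 ^ (α.1 - i)) *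
    (α.2.2.descFactorial k * t 3 ^ (α.2.2 - k)) * mul_descFactorial_succ_pow (t 2) α.2.1 j

lemma mul_jetSum_three :
    t 3 * jetSum S g i j (k + 1) n t =
      ∑ α ∈ S, ((α.2.2 : ℂ) - k) * (deriv^[n] (g α) (t 4) * monoJet i j k t α) := by
  rw [jetSum_eq_sum, Finset.mul_sum]
  refine Finset.sum_congr rfl fun α _ => ?_
  unfold monoJet
  linear_combination deriv^[n] (g α) (t 4) * (α.1.descFactorial i * t 1 ^ (α.1 - i)) *
    (α.2.1.descFactorial j * t 2 ^ (α.2.1 - j)) * mul_descFactorial_succ_pow (t 3) α.2.2 k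

end

/-- A polynomial over an infinite field that vanishes as a function is the zero polynomial. -/
lemma coeff_eq_zero_of_forall_sum_eq_zero {S : Finset (ℕ × ℕ × ℕ)} {c : ℕ × ℕ × ℕ → ℂ}
    (h : ∀ x y z : ℂ, ∑ α ∈ S, c α * (x ^ α.1 * y ^ α.2.1 * z ^ α.2.2) = 0) :
    ∀ α ∈ S, c α = 0 := by
  let e : ℕ × ℕ × ℕ → (Fin 3 →₀ ℕ) := fun α => Finsupp.equivFunOnFinite.symm ![α.1, α.2.1, α.2.2]
  have he : Function.Injective e := by
    rintro ⟨a, b, c⟩ ⟨a', b', c'⟩ hab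
    have h0 := DFunLike.congr_fun hab 0
    have h1 := DFunLike.congr_fun hab 1
    have h2 := DFunLike.congr_fun hab 2
    simp_all [e]
  have hp : (∑ α ∈ S, MvPolynomial.monomial (e α) (c α) : MvPolynomial (Fin 3) ℂ) = 0 := by
    refine MvPolynomial.funext fun v => ?_
    rw [map_sum, map_zero, ← h (v 0) (v 1) (v 2)]
    refine Finset.sum_congr rfl fun α _ => ?_
    simp [e, MvPolynomial.eval_monomial, Finsupp.prod_fintype, Fin.prod_univ_three]
  intro α hα
  have := congrArg (MvPolynomial.coeff (e α)) hp
  simpa [MvPolynomial.coeff_sum, MvPolynomial.coeff_monomial, he.eq_iff, hα] using this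

/-- The Euler field multiplies each monomial by its weighted degree. At `t^1 = 0` the cubic part
contributes nothing, so what remains is a vanishing polynomial with coefficients `(degree - 2)
g_α(τ)`. -/
theorem eq_zero_of_notMem_frobeniusSolutions {σ : ℝ} {U : Set ℂ} (hU : IsOpen U)
    {g : (ℕ × ℕ × ℕ) →₀ (ℂ → ℂ)} (hg : ∀ α, DifferentiableOn ℂ (g α) U)
    (hE : ∀ t ∈ regionOver U, eulerDeriv σ (prepotential g) t = 2 * prepotential g t)
    {α : ℕ × ℕ × ℕ} (hα : α ∉ frobeniusSolutions σ) {τ : ℂ} (hτ : τ ∈ U) : g α τ = 0 := by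
  by_cases hs : α ∈ g.support
  swap
  · rw [Finsupp.notMem_support_iff.mp hs]; rfl
  have key := coeff_eq_zero_of_forall_sum_eq_zero (S := g.support)
    (c := fun α => ((1 - σ) * α.1 + 1 / 2 * α.2.1 + σ * α.2.2 - 2) * g α τ) (fun x y z => by
      have ht : (![0, x, y, z, τ] : Fin 5 → ℂ) ∈ regionOver U := hτ
      have h := hE _ ht
      simp only [eulerDeriv, Fin.sum_univ_five,
        pd_prepotential hU (Finset.Subset.refl g.support) hg ht,
        prepotential_eq g (Finset.Subset.refl g.support)] at h
      have e1 := mul_jetSum_one g.support g 0 0 0 0 ![0, x, y, z, τ]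
      have e2 := mul_jetSum_two g.support g 0 0 0 0 ![0, x, y, z, τ]
      have e3 := mul_jetSum_three g.support g 0 0 0 0 ![0, x, y, z, τ]
      have e0 := jetSum_eq_sum g.support g 0 0 0 0 ![0, x, y, z, τ]
      simp [jet, eulerDegree, cubicGrad, cubic] at h e1 e2 e3 e0
      have : ∀ α ∈ g.support, ((1 - (σ : ℂ)) * α.1 + 1 / 2 * α.2.1 + σ * α.2.2 - 2) * g α τ *
          (x ^ α.1 * y ^ α.2.1 * z ^ α.2.2) =
          (1 - σ) * (α.1 * (g α τ * monoJet 0 0 0 ![0, x, y, z, τ] α)) +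
          1 / 2 * (α.2.1 * (g α τ * monoJet 0 0 0 ![0, x, y, z, τ] α)) +
          σ * (α.2.2 * (g α τ * monoJet 0 0 0 ![0, x, y, z, τ] α)) -
          2 * (g α τ * monoJet 0 0 0 ![0, x, y, z, τ] α) := fun α _ => by
        simp [monoJet]; ring
      rw [Finset.sum_congr rfl this, Finset.sum_sub_distrib, Finset.sum_add_distrib,
        Finset.sum_add_distrib, ← Finset.mul_sum, ← Finset.mul_sum, ← Finset.mul_sum,
        ← Finset.mul_sum, ← e1, ← e2, ← e3, ← e0]
      linear_combination h) α hs
  refine (mul_eq_zero.mp key).resolve_left fun h0 => hα ?_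
  have : (((1 - σ) * α.1 + 1 / 2 * α.2.1 + σ * α.2.2 - 2 : ℝ) : ℂ) = 0 := by
    push_cast
    linear_combination h0
  exact sub_eq_zero.mp (Complex.ofReal_eq_zero.mp this)

end

noncomputable section

/-! ### Polynomials in `t^4` -/

open Polynomial in
/-- The polynomial in `t^4` multiplying `(t^2)^a (t^3)^b` in the `n`-th derivative with respect
to `t^5`. -/
def colPoly (N : ℕ) (g : ℕ × ℕ × ℕ → ℂ → ℂ) (n : ℕ) (τ : ℂ) (a b : ℕ) : ℂ[X] :=
  ∑ c ∈ Finset.range N, C (deriv^[n] (g (a, b, c)) τ) * X ^ c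

lemma iterate_deriv_zero (n : ℕ) : deriv^[n] (0 : ℂ → ℂ) = 0 := by
  induction n with
  | zero => rfl
  | succ n ih =>
    rw [Function.iterate_succ_apply', ih]
    exact deriv_const' 0

lemma iterate_deriv_eq_zero {U : Set ℂ} (hU : IsOpen U) {f : ℂ → ℂ} (hf : ∀ τ ∈ U, f τ = 0)
    (n : ℕ) : ∀ τ ∈ U, deriv^[n] f τ = 0 := by
  induction n with
  | zero => exact hf
  | succ n ih =>
    intro τ hτ
    have h : deriv^[n] f =ᶠ[nhds τ] fun _ => (0 : ℂ) :=
      Filter.eventuallyEq_of_mem (hU.mem_nhds hτ) ih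
    rw [Function.iterate_succ_apply', h.deriv_eq, deriv_const]

/-- The box of multi-indices with entries less than `N`. -/
def box (N : ℕ) : Finset (ℕ × ℕ × ℕ) := Finset.range N ×ˢ Finset.range N ×ˢ Finset.range N

lemma mem_box {N : ℕ} {α : ℕ × ℕ × ℕ} : α ∈ box N ↔ α.1 < N ∧ α.2.1 < N ∧ α.2.2 < N := by
  simp [box]

/-- The bound `5 ≤ N` makes room for the exponent of `y⁴`. -/
lemma exists_subset_box (S : Finset (ℕ × ℕ × ℕ)) : ∃ N, 5 ≤ N ∧ S ⊆ box N := by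
  refine ⟨5 + ∑ α ∈ S, (α.1 + α.2.1 + α.2.2), Nat.le_add_right _ _, fun α hα => ?_⟩
  have := Finset.single_le_sum (f := fun α : ℕ × ℕ × ℕ => α.1 + α.2.1 + α.2.2)
    (fun _ _ => Nat.zero_le _) hα
  simp only [mem_box]
  omega

lemma coeff_colPoly {N : ℕ} {g : (ℕ × ℕ × ℕ) →₀ (ℂ → ℂ)} (hN : g.support ⊆ box N) (n : ℕ) (τ : ℂ)
    (a b c : ℕ) : (colPoly N g n τ a b).coeff c = deriv^[n] (g (a, b, c)) τ := by
  simp only [colPoly, Polynomial.finsetSum_coeff, Polynomial.coeff_C_mul_X_pow,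
    Finset.sum_ite_eq, Finset.mem_range]
  split_ifs with h
  · rfl
  · have : g (a, b, c) = 0 := by
      by_contra h0
      exact h (mem_box.mp (hN (Finsupp.mem_support_iff.mpr h0))).2.2
    rw [this, iterate_deriv_zero]; rfl

open Polynomial in
lemma eval_iterate_derivative_X_pow (z : ℂ) (c k : ℕ) :
    (derivative^[k] (X ^ c : ℂ[X])).eval z = c.descFactorial k * z ^ (c - k) := by
  rw [iterate_derivative_X_pow_eq_natCast_mul]; simp

open Polynomial in
lemma jetSum_box (N : ℕ) (g : ℕ × ℕ × ℕ → ℂ → ℂ) (i j k n : ℕ) (t : Fin 5 → ℂ) :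
    jetSum (box N) g i j k n t = ∑ p ∈ Finset.range N ×ˢ Finset.range N,
      (p.1.descFactorial i * t 1 ^ (p.1 - i)) * (p.2.descFactorial j * t 2 ^ (p.2 - j)) *
        (derivative^[k] (colPoly N g n (t 4) p.1 p.2)).eval (t 3) := by
  simp only [jetSum, box, Finset.sum_product, colPoly, iterate_derivative_sum,
    iterate_derivative_C_mul, eval_finsetSum, eval_mul, eval_C, eval_iterate_derivative_X_pow,
    Finset.mul_sum]
  refine Finset.sum_congr rfl fun a _ => Finset.sum_congr rfl fun b _ =>
    Finset.sum_congr rfl fun c _ => ?_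
  ring

/-- The coefficients of the prepotential have the shape forced by `σ < 1 / 2`. -/
structure HasShape (G : ℕ × ℕ × ℕ → ℂ) : Prop where
  eq_zero : ∀ a b c, (a, b, c) ≠ (2, 0, 2) → (a, b, c) ≠ (1, 2, 1) → (a, b, c) ≠ (0, 4, 0) →
    (a, b, c) ≠ (3, 0, 0) → (a, b, c) ≠ (2, 1, 0) → ¬ (a = 1 ∧ b = 0 ∧ 4 ≤ c) →
    ¬ (a = 1 ∧ b = 1 ∧ 3 ≤ c) → ¬ (a = 0 ∧ b = 0 ∧ 5 ≤ c) → ¬ (a = 0 ∧ b = 1 ∧ 4 ≤ c) →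
    ¬ (a = 0 ∧ b = 2 ∧ 3 ≤ c) → ¬ (a = 0 ∧ b = 3 ∧ 2 ≤ c) → G (a, b, c) = 0

open Polynomial in
/-- The jets of the prepotential in terms of polynomials in `t^4`. -/
lemma jetSum_shape {N : ℕ} {g : (ℕ × ℕ × ℕ) →₀ (ℂ → ℂ)} (h5 : 5 ≤ N) (hN : g.support ⊆ box N)
    (n : ℕ) (x y z τ : ℂ) (hG : HasShape fun α => deriv^[n] (g α) τ) (i j k : ℕ) :
    jetSum (box N) g i j k n ![0, x, y, z, τ] =
      (Nat.descFactorial 3 i * x ^ (3 - i)) * (Nat.descFactorial 0 j * y ^ (0 - j)) *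
        (deriv^[n] (g (3, 0, 0)) τ * (Nat.descFactorial 0 k * z ^ (0 - k))) +
      (Nat.descFactorial 2 i * x ^ (2 - i)) * (Nat.descFactorial 1 j * y ^ (1 - j)) *
        (deriv^[n] (g (2, 1, 0)) τ * (Nat.descFactorial 0 k * z ^ (0 - k))) +
      (Nat.descFactorial 2 i * x ^ (2 - i)) * (Nat.descFactorial 0 j * y ^ (0 - j)) *
        (deriv^[n] (g (2, 0, 2)) τ * (Nat.descFactorial 2 k * z ^ (2 - k))) +
      (Nat.descFactorial 1 i * x ^ (1 - i)) * (Nat.descFactorial 2 j * y ^ (2 - j)) *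
        (deriv^[n] (g (1, 2, 1)) τ * (Nat.descFactorial 1 k * z ^ (1 - k))) +
      (Nat.descFactorial 0 i * x ^ (0 - i)) * (Nat.descFactorial 4 j * y ^ (4 - j)) *
        (deriv^[n] (g (0, 4, 0)) τ * (Nat.descFactorial 0 k * z ^ (0 - k))) +
      (Nat.descFactorial 1 i * x ^ (1 - i)) * (Nat.descFactorial 0 j * y ^ (0 - j)) *
        (derivative^[k] (colPoly N g n τ 1 0)).eval z +
      (Nat.descFactorial 1 i * x ^ (1 - i)) * (Nat.descFactorial 1 j * y ^ (1 - j)) *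
        (derivative^[k] (colPoly N g n τ 1 1)).eval z +
      (Nat.descFactorial 0 i * x ^ (0 - i)) * (Nat.descFactorial 0 j * y ^ (0 - j)) *
        (derivative^[k] (colPoly N g n τ 0 0)).eval z +
      (Nat.descFactorial 0 i * x ^ (0 - i)) * (Nat.descFactorial 1 j * y ^ (1 - j)) *
        (derivative^[k] (colPoly N g n τ 0 1)).eval z +
      (Nat.descFactorial 0 i * x ^ (0 - i)) * (Nat.descFactorial 2 j * y ^ (2 - j)) *
        (derivative^[k] (colPoly N g n τ 0 2)).eval z +
      (Nat.descFactorial 0 i * x ^ (0 - i)) * (Nat.descFactorial 3 j * y ^ (3 - j)) *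
        (derivative^[k] (colPoly N g n τ 0 3)).eval z := by
  -- Five of the columns allow a single power of `z`; the other six remain general polynomials.
  have hmono : ∀ a b c, (∀ c', c' ≠ c → deriv^[n] (g (a, b, c')) τ = 0) →
      colPoly N g n τ a b = C (deriv^[n] (g (a, b, c)) τ) * X ^ c := fun a b c h => by
    ext c'
    rw [coeff_colPoly hN, coeff_C_mul_X_pow]
    split_ifs with hc
    · rw [hc]
    · exact h c' hc
  have e30 := hmono 3 0 0 fun c' hc => hG.eq_zero _ _ _ (by simp) (by simp) (by simp) (by simp [hc])
    (by simp) (by simp) (by simp) (by simp) (by simp) (by simp) (by simp)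
  have e21 := hmono 2 1 0 fun c' hc => hG.eq_zero _ _ _ (by simp) (by simp) (by simp) (by simp)
    (by simp [hc]) (by simp) (by simp) (by simp) (by simp) (by simp) (by simp)
  have e20 := hmono 2 0 2 fun c' hc => hG.eq_zero _ _ _ (by simp [hc]) (by simp) (by simp) (by simp)
    (by simp) (by simp) (by simp) (by simp) (by simp) (by simp) (by simp)
  have e12 := hmono 1 2 1 fun c' hc => hG.eq_zero _ _ _ (by simp) (by simp [hc]) (by simp) (by simp)
    (by simp) (by simp) (by simp) (by simp) (by simp) (by simp) (by simp)
  have e04 := hmono 0 4 0 fun c' hc => hG.eq_zero _ _ _ (by simp) (by simp) (by simp [hc]) (by simp)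
    (by simp) (by simp) (by simp) (by simp) (by simp) (by simp) (by simp)
  have hsub : ({(3, 0), (2, 1), (2, 0), (1, 2), (0, 4), (1, 0), (1, 1), (0, 0), (0, 1), (0, 2),
      (0, 3)} : Finset (ℕ × ℕ)) ⊆ Finset.range N ×ˢ Finset.range N := by
    intro p hp
    simp only [Finset.mem_insert, Finset.mem_singleton] at hp
    rcases hp with rfl | rfl | rfl | rfl | rfl | rfl | rfl | rfl | rfl | rfl | rfl <;>
      simp <;> omega
  rw [jetSum_box, ← Finset.sum_subset hsub]
  · simp only [Finset.sum_insert, Finset.mem_insert, Finset.mem_singleton, Prod.mk.injEq,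
      Finset.sum_singleton, OfNat.ofNat_ne_zero, one_ne_zero, zero_ne_one,
      OfNat.ofNat_ne_one, OfNat.one_ne_ofNat, OfNat.zero_ne_ofNat, and_false, and_true,
      or_false, not_false_eq_true, Nat.reduceEqDiff, and_self]
    simp only [Matrix.cons_val, e30, e21, e20, e12, e04, iterate_derivative_C_mul, eval_mul, eval_C,
      eval_iterate_derivative_X_pow]
    ring
  · rintro ⟨a, b⟩ - hp
    simp only [Finset.mem_insert, Finset.mem_singleton, Prod.mk.injEq, not_or] at hp
    have : colPoly N g n τ a b = 0 := by
      ext c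
      rw [coeff_colPoly hN, coeff_zero]
      refine hG.eq_zero _ _ _ ?_ ?_ ?_ ?_ ?_ ?_ ?_ ?_ ?_ ?_ ?_ <;> simp <;> omega
    simp only [Matrix.cons_val, this, iterate_derivative_zero, eval_zero, mul_zero]

end

noncomputable section

/-! ### The WDVV equations, coefficient by coefficient -/

/-- These are the only monomials in `x, y` that occur in the six expanded equations; evaluation at a
few integer points separates them. -/
lemma cubic_coeffs_eq_zero {c0 cx cy cxx cxy cyy cyyy : ℂ}
    (h : ∀ x y : ℂ,
      c0 + cx * x + cy * y + cxx * x ^ 2 + cxy * x * y + cyy * y ^ 2 + cyyy * y ^ 3 = 0) :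
    c0 = 0 ∧ cx = 0 ∧ cy = 0 ∧ cxx = 0 ∧ cxy = 0 ∧ cyy = 0 ∧ cyyy = 0 := by
  have h0 : c0 = 0 := by linear_combination h 0 0
  have hx : cx = 0 := by linear_combination (h 1 0 - h (-1) 0) / 2
  have hxx : cxx = 0 := by linear_combination (h 1 0 + h (-1) 0) / 2 - h0
  have hyy : cyy = 0 := by linear_combination (h 0 1 + h 0 (-1)) / 2 - h0
  have hyyy : cyyy = 0 := by
    linear_combination (h 0 2 - h 0 (-2) - 2 * (h 0 1 - h 0 (-1))) / 12
  have hy : cy = 0 := by linear_combination (h 0 1 - h 0 (-1)) / 2 - hyyy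
  exact ⟨h0, hx, hy, hxx, by linear_combination h 1 1 - h0 - hx - hy - hxx - hyy - hyyy, hyy, hyyy⟩

open Polynomial in
/-- The coefficients of the WDVV equations for
`k₃ x³ + k₂ x² y + a x² z² + b x y² z + c y⁴ + x p + x y q + r + y s + y² u + y³ v`, where
`p, …, v` are polynomials in `z`, in terms of the values and the derivatives (`dk₃, …, dv`) of the
coefficients. -/
structure ReducedWDVV (k₃ k₂ a b c : ℂ) (p q r s u v : ℂ[X]) (dk₃ dk₂ da db dc : ℂ)
    (dp dq dr ds du dv : ℂ[X]) : Prop where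
  xxzz_one : ∀ z, 6 * k₃ * (derivative^[3] r).eval z + 2 * k₂ * (derivative^[2] s).eval z
    - 4 * a * z * (derivative^[2] p).eval z - (derivative^[1] q).eval z ^ 2
    = 2 * (derivative^[1] dp).eval z
  xxzz_x : ∀ z, 6 * k₃ * (derivative^[3] p).eval z + 2 * k₂ * (derivative^[2] q).eval z
    - 16 * a ^ 2 * z = 8 * da * z
  xxzz_y : ∀ z, 6 * k₃ * (derivative^[3] s).eval z + 4 * k₂ * (derivative^[2] u).eval z
    - 4 * a * z * (derivative^[2] q).eval z - 4 * b * (derivative^[1] q).eval z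
    = 2 * (derivative^[1] dq).eval z
  xxzz_yy : ∀ z, 6 * k₃ * (derivative^[3] u).eval z + 6 * k₂ * (derivative^[2] v).eval z
    - 4 * b ^ 2 = 2 * db
  xxyy_one : ∀ z, 4 * k₂ * (derivative^[1] q).eval z + 4 * b ^ 2 * z ^ 2
    = 12 * k₃ * (derivative^[1] u).eval z + 12 * k₂ * v.eval z + 8 * a * b * z ^ 2
      + 2 * da * z ^ 2
  xxyy_x : 0 = 12 * k₃ * b + 6 * dk₃
  xxyy_y : ∀ z, 8 * k₂ * b = 36 * k₃ * (derivative^[1] v).eval z + 48 * k₂ * c + 2 * dk₂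
  zzxy_one : ∀ z, (derivative^[1] ds).eval z = (2 * b - 4 * a) * z * (derivative^[2] s).eval z
    - 2 * (derivative^[1] q).eval z * (derivative^[1] u).eval z
    + 2 * k₂ * (derivative^[3] r).eval z
  zzxy_x : ∀ z, (derivative^[1] dq).eval z = (2 * b - 4 * a) * z * (derivative^[2] q).eval z
    - 2 * b * (derivative^[1] q).eval z + 2 * k₂ * (derivative^[3] p).eval z
  zzxy_y : ∀ z, 2 * (derivative^[1] du).eval z
    = 2 * (2 * b - 4 * a) * z * (derivative^[2] u).eval z - 4 * b * (derivative^[1] u).eval z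
      - 6 * (derivative^[1] q).eval z * (derivative^[1] v).eval z
      + 2 * k₂ * (derivative^[3] s).eval z
  zzxy_xy : ∀ z, 2 * db = -4 * b ^ 2 + 2 * k₂ * (derivative^[3] q).eval z
  zzxy_yy : ∀ z, 3 * (derivative^[1] dv).eval z
    = 3 * (2 * b - 4 * a) * z * (derivative^[2] v).eval z - 12 * b * (derivative^[1] v).eval z
      + 2 * k₂ * (derivative^[3] u).eval z
  zzyy_one : ∀ z, (derivative^[2] dr).eval z
    = (derivative^[2] s).eval z * (2 * (derivative^[1] q).eval z - 6 * v.eval z)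
      + 2 * (derivative^[1] u).eval z * (2 * (derivative^[1] u).eval z - (derivative^[2] p).eval z)
      - 2 * b * z * (derivative^[3] r).eval z
  zzyy_x : ∀ z, (derivative^[2] dp).eval z
    = (derivative^[2] q).eval z * (2 * (derivative^[1] q).eval z - 6 * v.eval z)
      + 2 * b * (2 * (derivative^[1] u).eval z - (derivative^[2] p).eval z)
      + 2 * (derivative^[1] u).eval z * (2 * b - 4 * a) - 2 * b * z * (derivative^[3] p).eval z
  zzyy_y : ∀ z, (derivative^[2] ds).eval z
    = (4 * b - 24 * c) * (derivative^[2] s).eval z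
      + 2 * (derivative^[2] u).eval z * (2 * (derivative^[1] q).eval z - 6 * v.eval z)
      + 2 * (derivative^[1] u).eval z * (6 * (derivative^[1] v).eval z - (derivative^[2] q).eval z)
      + 6 * (derivative^[1] v).eval z * (2 * (derivative^[1] u).eval z - (derivative^[2] p).eval z)
      - 2 * b * z * (derivative^[3] s).eval z
  zzyy_xx : 2 * da = 2 * b * (2 * b - 4 * a)
  zzyy_xy : ∀ z, (derivative^[2] dq).eval z
    = (4 * b - 24 * c) * (derivative^[2] q).eval z
      + 2 * b * (6 * (derivative^[1] v).eval z - (derivative^[2] q).eval z)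
      + 6 * (derivative^[1] v).eval z * (2 * b - 4 * a) - 2 * b * z * (derivative^[3] q).eval z
  zzyy_yy : ∀ z, (derivative^[2] du).eval z
    = (4 * b - 24 * c) * 2 * (derivative^[2] u).eval z
      + 3 * (derivative^[2] v).eval z * (2 * (derivative^[1] q).eval z - 6 * v.eval z)
      + 6 * (derivative^[1] v).eval z * (6 * (derivative^[1] v).eval z - (derivative^[2] q).eval z)
      - 2 * b * z * (derivative^[3] u).eval z
  zzyy_yyy : ∀ z, (derivative^[2] dv).eval z
    = 3 * (4 * b - 24 * c) * (derivative^[2] v).eval z - 2 * b * z * (derivative^[3] v).eval z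
  xzyy_one : ∀ z, 2 * du.eval z + (derivative^[1] dp).eval z
    = 2 * k₂ * (derivative^[2] s).eval z + (2 * b - 4 * a) * z * 2 * (derivative^[1] u).eval z
      + (derivative^[1] q).eval z ^ 2 - 6 * (derivative^[1] q).eval z * v.eval z
      - 2 * b * z * (derivative^[2] p).eval z
  xzyy_x : ∀ z, 2 * db * z + 4 * da * z = 2 * k₂ * (derivative^[2] q).eval z
    + (2 * b - 4 * a) * z * 2 * b - 8 * a * b * z
  xzyy_y : ∀ z, 6 * dv.eval z + (derivative^[1] dq).eval z
    = 4 * k₂ * (derivative^[2] u).eval z + (2 * b - 4 * a) * z * 6 * (derivative^[1] v).eval z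
      + 4 * b * (derivative^[1] q).eval z - 24 * c * (derivative^[1] q).eval z - 12 * b * v.eval z
      - 2 * b * z * (derivative^[2] q).eval z
  xzyy_yy : ∀ z, 12 * dc + db = 6 * k₂ * (derivative^[2] v).eval z + 4 * b ^ 2 - 48 * b * c
  xxyz_one : ∀ z, dq.eval z = 6 * k₃ * (derivative^[2] s).eval z
    + 2 * k₂ * (2 * (derivative^[1] u).eval z - (derivative^[2] p).eval z)
    - 2 * b * z * (derivative^[1] q).eval z
  xxyz_x : ∀ z, 2 * dk₂ = 6 * k₃ * (derivative^[2] q).eval z + 2 * k₂ * (2 * b - 4 * a)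

open Polynomial in
/-- The reduced equations hold for a solution of WDVV of the right shape. -/
theorem reducedWDVV_of_solvesWDVV {U : Set ℂ} (hU : IsOpen U) {g : (ℕ × ℕ × ℕ) →₀ (ℂ → ℂ)}
    (hg : ∀ α, DifferentiableOn ℂ (g α) U) (hW : SolvesWDVV (prepotential g) (regionOver U))
    {N : ℕ} (h5 : 5 ≤ N) (hN : g.support ⊆ box N) {τ : ℂ} (hτ : τ ∈ U)
    (hG : ∀ n, HasShape fun α => deriv^[n] (g α) τ) :
    ReducedWDVV (g (3, 0, 0) τ) (g (2, 1, 0) τ) (g (2, 0, 2) τ) (g (1, 2, 1) τ) (g (0, 4, 0) τ)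
      (colPoly N g 0 τ 1 0) (colPoly N g 0 τ 1 1) (colPoly N g 0 τ 0 0) (colPoly N g 0 τ 0 1)
      (colPoly N g 0 τ 0 2) (colPoly N g 0 τ 0 3)
      (deriv (g (3, 0, 0)) τ) (deriv (g (2, 1, 0)) τ) (deriv (g (2, 0, 2)) τ)
      (deriv (g (1, 2, 1)) τ) (deriv (g (0, 4, 0)) τ)
      (colPoly N g 1 τ 1 0) (colPoly N g 1 τ 1 1) (colPoly N g 1 τ 0 0) (colPoly N g 1 τ 0 1)
      (colPoly N g 1 τ 0 2) (colPoly N g 1 τ 0 3) := by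
  have ht : ∀ x y z : ℂ, (![0, x, y, z, τ] : Fin 5 → ℂ) ∈ regionOver U := fun x y z => hτ
  have J := fun i j k n x y z => jetSum_shape h5 hN n x y z τ (hG n) i j k
  have E1 := fun x y z => wdvv_xx_zz hU hN hg (ht x y z) hW
  have E2 := fun x y z => wdvv_xx_yy hU hN hg (ht x y z) hW
  have E3 := fun x y z => wdvv_zz_xy hU hN hg (ht x y z) hW
  have E4 := fun x y z => wdvv_zz_yy hU hN hg (ht x y z) hW
  have E5 := fun x y z => wdvv_xz_yy hU hN hg (ht x y z) hW
  have E6 := fun x y z => wdvv_xx_yz hU hN hg (ht x y z) hW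
  simp only [J] at E1 E2 E3 E4 E5 E6
  -- At fixed `τ` the values and the derivatives become independent letters, and only polynomial
  -- algebra is left.
  generalize colPoly N g 0 τ 1 0 = p at *
  generalize colPoly N g 0 τ 1 1 = q at *
  generalize colPoly N g 0 τ 0 0 = r at *
  generalize colPoly N g 0 τ 0 1 = s at *
  generalize colPoly N g 0 τ 0 2 = u at *
  generalize colPoly N g 0 τ 0 3 = v at *
  generalize colPoly N g 1 τ 1 0 = dp at *
  generalize colPoly N g 1 τ 1 1 = dq at *
  generalize colPoly N g 1 τ 0 0 = dr at *
  generalize colPoly N g 1 τ 0 1 = ds at *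
  generalize colPoly N g 1 τ 0 2 = du at *
  generalize colPoly N g 1 τ 0 3 = dv at *
  simp only [Nat.descFactorial_succ, Nat.descFactorial_zero, Function.iterate_zero, id,
    Function.iterate_one] at E1 E2 E3 E4 E5 E6
  generalize g (3, 0, 0) τ = k₃ at *
  generalize g (2, 1, 0) τ = k₂ at *
  generalize g (2, 0, 2) τ = a at *
  generalize g (1, 2, 1) τ = b at *
  generalize g (0, 4, 0) τ = c at *
  generalize deriv (g (3, 0, 0)) τ = dk₃ at *
  generalize deriv (g (2, 1, 0)) τ = dk₂ at *
  generalize deriv (g (2, 0, 2)) τ = da at *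
  generalize deriv (g (1, 2, 1)) τ = db at *
  generalize deriv (g (0, 4, 0)) τ = dc at *
  clear J hG
  simp at E1 E2 E3 E4 E5 E6
  -- For fixed `z`, each equation is a polynomial in `x` and `y`. All its coefficients must be
  -- supplied for the expansion to match, including those not recorded in `ReducedWDVV`.
  have C1 := fun z => cubic_coeffs_eq_zero
    (c0 := 6 * k₃ * (derivative (derivative (derivative (r)))).eval z + 2 * k₂ * (derivative
      (derivative (s))).eval z - 4 * a * z * (derivative (derivative (p))).eval z - (derivative
      (q)).eval z ^ 2 - (2 * (derivative (dp)).eval z))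
    (cx := 6 * k₃ * (derivative (derivative (derivative (p)))).eval z + 2 * k₂ * (derivative
      (derivative (q))).eval z - 16 * a ^ 2 * z - (8 * da * z))
    (cy := 6 * k₃ * (derivative (derivative (derivative (s)))).eval z + 4 * k₂ * (derivative
      (derivative (u))).eval z - 4 * a * z * (derivative (derivative (q))).eval z - 4 * b *
      (derivative (q)).eval z - (2 * (derivative (dq)).eval z))
    (cxx := 0)
    (cxy := 6 * k₃ * (derivative (derivative (derivative q))).eval z)
    (cyy := 6 * k₃ * (derivative (derivative (derivative (u)))).eval z + 6 * k₂ * (derivative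
      (derivative (v))).eval z - 4 * b ^ 2 - (2 * db))
    (cyyy := 6 * k₃ * (derivative (derivative (derivative v))).eval z)
    (fun x y => by linear_combination E1 x y z)
  have C2 := fun z => cubic_coeffs_eq_zero
    (c0 := 4 * k₂ * (derivative (q)).eval z + 4 * b ^ 2 * z ^ 2 - (12 * k₃ * (derivative (u)).eval
      z + 12 * k₂ * v.eval z + 8 * a * b * z ^ 2 + 2 * da * z ^ 2))
    (cx := -(12 * k₃ * b + 6 * dk₃))
    (cy := 8 * k₂ * b - (36 * k₃ * (derivative (v)).eval z + 48 * k₂ * c + 2 * dk₂))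
    (cxx := 0)
    (cxy := 0)
    (cyy := 0)
    (cyyy := 0)
    (fun x y => by linear_combination E2 x y z)
  have C3 := fun z => cubic_coeffs_eq_zero
    (c0 := (derivative (ds)).eval z - ((2 * b - 4 * a) * z * (derivative (derivative (s))).eval z
      - 2 * (derivative (q)).eval z * (derivative (u)).eval z + 2 * k₂ * (derivative (derivative
      (derivative (r)))).eval z))
    (cx := (derivative (dq)).eval z - ((2 * b - 4 * a) * z * (derivative (derivative (q))).eval z
      - 2 * b * (derivative (q)).eval z + 2 * k₂ * (derivative (derivative (derivative (p)))).eval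
      z))
    (cy := 2 * (derivative (du)).eval z - (2 * (2 * b - 4 * a) * z * (derivative (derivative
      (u))).eval z - 4 * b * (derivative (u)).eval z - 6 * (derivative (q)).eval z * (derivative
      (v)).eval z + 2 * k₂ * (derivative (derivative (derivative (s)))).eval z))
    (cxx := 0)
    (cxy := 2 * db - (-4 * b ^ 2 + 2 * k₂ * (derivative (derivative (derivative (q)))).eval z))
    (cyy := 3 * (derivative (dv)).eval z - (3 * (2 * b - 4 * a) * z * (derivative (derivative
      (v))).eval z - 12 * b * (derivative (v)).eval z + 2 * k₂ * (derivative (derivative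
      (derivative (u)))).eval z))
    (cyyy := -(2 * k₂ * (derivative (derivative (derivative v))).eval z))
    (fun x y => by linear_combination E3 x y z)
  have C4 := fun z => cubic_coeffs_eq_zero
    (c0 := (derivative (derivative (dr))).eval z - ((derivative (derivative (s))).eval z * (2 *
      (derivative (q)).eval z - 6 * v.eval z) + 2 * (derivative (u)).eval z * (2 * (derivative
      (u)).eval z - (derivative (derivative (p))).eval z) - 2 * b * z * (derivative (derivative
      (derivative (r)))).eval z))
    (cx := (derivative (derivative (dp))).eval z - ((derivative (derivative (q))).eval z * (2 *
      (derivative (q)).eval z - 6 * v.eval z) + 2 * b * (2 * (derivative (u)).eval z - (derivative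
      (derivative (p))).eval z) + 2 * (derivative (u)).eval z * (2 * b - 4 * a) - 2 * b * z *
      (derivative (derivative (derivative (p)))).eval z))
    (cy := (derivative (derivative (ds))).eval z - ((4 * b - 24 * c) * (derivative (derivative
      (s))).eval z + 2 * (derivative (derivative (u))).eval z * (2 * (derivative (q)).eval z - 6 *
      v.eval z) + 2 * (derivative (u)).eval z * (6 * (derivative (v)).eval z - (derivative
      (derivative (q))).eval z) + 6 * (derivative (v)).eval z * (2 * (derivative (u)).eval z -
      (derivative (derivative (p))).eval z) - 2 * b * z * (derivative (derivative (derivative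
      (s)))).eval z))
    (cxx := 2 * da - (2 * b * (2 * b - 4 * a)))
    (cxy := (derivative (derivative (dq))).eval z - ((4 * b - 24 * c) * (derivative (derivative
      (q))).eval z + 2 * b * (6 * (derivative (v)).eval z - (derivative (derivative (q))).eval z)
      + 6 * (derivative (v)).eval z * (2 * b - 4 * a) - 2 * b * z * (derivative (derivative
      (derivative (q)))).eval z))
    (cyy := (derivative (derivative (du))).eval z - ((4 * b - 24 * c) * 2 * (derivative
      (derivative (u))).eval z + 3 * (derivative (derivative (v))).eval z * (2 * (derivative
      (q)).eval z - 6 * v.eval z) + 6 * (derivative (v)).eval z * (6 * (derivative (v)).eval z -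
      (derivative (derivative (q))).eval z) - 2 * b * z * (derivative (derivative (derivative
      (u)))).eval z))
    (cyyy := (derivative (derivative (dv))).eval z - (3 * (4 * b - 24 * c) * (derivative
      (derivative (v))).eval z - 2 * b * z * (derivative (derivative (derivative (v)))).eval z))
    (fun x y => by linear_combination E4 x y z)
  have C5 := fun z => cubic_coeffs_eq_zero
    (c0 := 2 * du.eval z + (derivative (dp)).eval z - (2 * k₂ * (derivative (derivative (s))).eval
      z + (2 * b - 4 * a) * z * 2 * (derivative (u)).eval z + (derivative (q)).eval z ^ 2 - 6 *
      (derivative (q)).eval z * v.eval z - 2 * b * z * (derivative (derivative (p))).eval z))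
    (cx := 2 * db * z + 4 * da * z - (2 * k₂ * (derivative (derivative (q))).eval z + (2 * b - 4 *
      a) * z * 2 * b - 8 * a * b * z))
    (cy := 6 * dv.eval z + (derivative (dq)).eval z - (4 * k₂ * (derivative (derivative (u))).eval
      z + (2 * b - 4 * a) * z * 6 * (derivative (v)).eval z + 4 * b * (derivative (q)).eval z - 24
      * c * (derivative (q)).eval z - 12 * b * v.eval z - 2 * b * z * (derivative (derivative
      (q))).eval z))
    (cxx := 0)
    (cxy := 0)
    (cyy := 12 * dc + db - (6 * k₂ * (derivative (derivative (v))).eval z + 4 * b ^ 2 - 48 * b *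
      c))
    (cyyy := 0)
    (fun x y => by linear_combination E5 x y z)
  have C6 := fun z => cubic_coeffs_eq_zero
    (c0 := dq.eval z - (6 * k₃ * (derivative (derivative (s))).eval z + 2 * k₂ * (2 * (derivative
      (u)).eval z - (derivative (derivative (p))).eval z) - 2 * b * z * (derivative (q)).eval z))
    (cx := 2 * dk₂ - (6 * k₃ * (derivative (derivative (q))).eval z + 2 * k₂ * (2 * b - 4 * a)))
    (cy := 2 * db * z - (12 * k₃ * (derivative (derivative u)).eval z + 2 * k₂ * (6 * (derivative
      v).eval z - (derivative (derivative q)).eval z) - 4 * b ^ 2 * z))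
    (cxx := 0)
    (cxy := 0)
    (cyy := -(18 * k₃ * (derivative (derivative v)).eval z))
    (cyyy := 0)
    (fun x y => by linear_combination E6 x y z)
  constructor
  all_goals try simp only [Function.iterate_succ, Function.iterate_zero, Function.comp_apply, id]
  · exact fun z => by linear_combination (C1 z).1
  · exact fun z => by linear_combination (C1 z).2.1
  · exact fun z => by linear_combination (C1 z).2.2.1
  · exact fun z => by linear_combination (C1 z).2.2.2.2.2.1
  · exact fun z => by linear_combination (C2 z).1
  · linear_combination (C2 0).2.1
  · exact fun z => by linear_combination (C2 z).2.2.1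
  · exact fun z => by linear_combination (C3 z).1
  · exact fun z => by linear_combination (C3 z).2.1
  · exact fun z => by linear_combination (C3 z).2.2.1
  · exact fun z => by linear_combination (C3 z).2.2.2.2.1
  · exact fun z => by linear_combination (C3 z).2.2.2.2.2.1
  · exact fun z => by linear_combination (C4 z).1
  · exact fun z => by linear_combination (C4 z).2.1
  · exact fun z => by linear_combination (C4 z).2.2.1
  · linear_combination (C4 0).2.2.2.1
  · exact fun z => by linear_combination (C4 z).2.2.2.2.1
  · exact fun z => by linear_combination (C4 z).2.2.2.2.2.1
  · exact fun z => by linear_combination (C4 z).2.2.2.2.2.2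
  · exact fun z => by linear_combination (C5 z).1
  · exact fun z => by linear_combination (C5 z).2.1
  · exact fun z => by linear_combination (C5 z).2.2.1
  · exact fun z => by linear_combination (C5 z).2.2.2.2.2.1
  · exact fun z => by linear_combination (C6 z).1
  · exact fun z => by linear_combination (C6 z).2.1

end

noncomputable section

/-! ### Solving the reduced equations -/

open Polynomial

/-- This is `σ = 1/3`, where `x³` is allowed. The decisive relation is `(a - b) u = 0`: it removes
the cross terms from the equations for `p` and `u`. -/
lemma reducedWDVV_third {k a b c p r u dk da db dc dp dr du : ℂ}
    (R : ReducedWDVV k 0 a b c (C p * X ^ 4) 0 (C r * X ^ 6) 0 (C u * X ^ 3) 0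
      dk 0 da db dc (C dp * X ^ 4) 0 (C dr * X ^ 6) 0 (C du * X ^ 3) 0) :
    db = -2 * b ^ 2 ∧ dk = -2 * b * k ∧ da - db = -4 * b * (a - b) ∧
      dc = 1 / 2 * b ^ 2 - 4 * b * c ∧ dp = -6 * b * p ∧ du = -6 * b * u ∧
      30 * (dr + 8 * b * r) = 36 * u ^ 2 - 72 * p * u := by
  have e1 := R.xxzz_x 1
  have e2 := R.xxyy_one 1
  have e3 := R.zzxy_xy 1
  have e4 := R.zzyy_xx
  have e5 := R.xxyy_x
  have e6 := R.xzyy_yy 1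
  have e7 := R.zzyy_x 1
  have e8 := R.zzyy_one 1
  have e9 := R.zzxy_y 1
  simp at e1 e2 e3 e4 e5 e6 e7 e8 e9
  have hku : k * u = 0 := by linear_combination -(e2 + e4) / 36
  have hd : (a - b) ^ 2 = 9 * (k * p) := by linear_combination -e4 / 4 - e1 / 16
  have hdu : (a - b) * u = 0 := by
    -- Since `(a - b)² = 9kp` and `ku = 0`, the square of `(a - b) u` vanishes.
    have : ((a - b) * u) ^ 2 = 0 := by linear_combination u ^ 2 * hd + 9 * p * u * hku
    exact pow_eq_zero_iff (two_ne_zero) |>.mp this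
  refine ⟨by linear_combination e3 / 2, by linear_combination -e5 / 6,
    by linear_combination e4 / 2 - e3 / 2, by linear_combination e6 / 12 - e3 / 24, ?_, ?_, ?_⟩
  · linear_combination e7 / 12 - 2 * hdu
  · linear_combination e9 / 6 - 8 * hdu
  · linear_combination e8

/-- This is `σ = 1/4`, where `x² y` is allowed. Now `b' = -2b² + 6kv`, so `b` alone need not solve a
Riccati equation, but the extra term cancels in `2a - b`. The last conclusion is what keeps the
forcing term of `r` homogeneous, since that term contains `(a - b) r` and `r'` contains the forcing
term again. -/
lemma reducedWDVV_quarter {k a b c p q r s u v dk da db dc dp dq dr ds du dv : ℂ}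
    (R : ReducedWDVV 0 k a b c (C p * X ^ 5) (C q * X ^ 3) (C r * X ^ 8) (C s * X ^ 6)
      (C u * X ^ 4) (C v * X ^ 2) 0 dk da db dc (C dp * X ^ 5) (C dq * X ^ 3) (C dr * X ^ 8)
      (C ds * X ^ 6) (C du * X ^ 4) (C dv * X ^ 2)) :
    2 * da - db = -2 * (2 * a - b) ^ 2 ∧ dk = -2 * (2 * a - b) * k ∧
      da - db = -4 * (2 * a - b) * (a - b) ∧
      dc - (2 * da - db) / 4 = -4 * (2 * a - b) * (c - (2 * a - b) / 4) ∧
      dp = -8 * (2 * a - b) * p ∧ dq = -6 * (2 * a - b) * q ∧ dv = -6 * (2 * a - b) * v ∧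
      du = -8 * (2 * a - b) * u ∧ ds = -10 * (2 * a - b) * s ∧
      56 * (dr + 12 * (2 * a - b) * r) =
        64 * u ^ 2 - 160 * u * p + 1344 * ((a - b) * r) ∧
      (a - b) * (64 * u ^ 2 - 160 * u * p + 1344 * ((a - b) * r)) = 0 := by
  have xxzz1 := R.xxzz_one 1
  have xxzzx := R.xxzz_x 1
  have xxzzy := R.xxzz_y 1
  have xxzzyy := R.xxzz_yy 1
  have xxyy1 := R.xxyy_one 1
  have xxyyy := R.xxyy_y 1
  have zzxy1 := R.zzxy_one 1
  have zzxyx := R.zzxy_x 1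
  have zzxyy := R.zzxy_y 1
  have zzxyxy := R.zzxy_xy 1
  have zzxyyy := R.zzxy_yy 1
  have zzyy1 := R.zzyy_one 1
  have zzyyx := R.zzyy_x 1
  have zzyyy := R.zzyy_y 1
  have zzyyxx := R.zzyy_xx
  have zzyyxy := R.zzyy_xy 1
  have zzyyyy := R.zzyy_yy 1
  have zzyyyyy := R.zzyy_yyy 1
  have xzyyy := R.xzyy_y 1
  have xzyyyy := R.xzyy_yy 1
  have xxyz1 := R.xxyz_one 1
  have xxyzx := R.xxyz_x 1
  clear R
  simp at xxzz1 xxzzx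
  simp at xxzzy
  simp at xxzzyy xxyy1 xxyyy zzxy1 zzxyx zzxyy
  simp at zzxyxy
  simp at zzxyyy zzyy1 zzyyx
  simp at zzyyy zzyyxy zzyyyy zzyyyyy
  simp at xzyyy xzyyyy xxyz1 xxyzx
  have hkv : k * v = k * q := by linear_combination (xxzzyy + zzxyxy) / 12
  have hkq : 3 * (k * q) = 4 * (a - b) ^ 2 := by linear_combination xxzzx / 4 + zzyyxx
  have hdk : dk = -2 * (2 * a - b) * k := by linear_combination xxyzx / 2
  have hkm : k * (12 * c - b - 2 * a) = 0 := by linear_combination -xxyyy / 4 - hdk / 2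
  -- If `k = 0`, then `a = b` and the relations force `q = v = 0`. If `k ≠ 0`, the relations can be
  -- divided by `k` and determine all other coefficients.
  by_cases hk : k = 0
  · subst hk
    have hab : a - b = 0 := by
      rw [← pow_eq_zero_iff two_ne_zero]
      linear_combination -hkq / 4
    obtain rfl : a = b := sub_eq_zero.mp hab
    have hq : dq = -6 * a * q := by linear_combination -xxzzy / 6
    have hv : dv = -6 * a * v := by linear_combination zzxyyy / 6
    have hqm : q * (4 * c - a) = 0 := by linear_combination (xzyyy - 6 * hv - 3 * hq) / 18
    have hvm : v * (4 * c - a) = 0 := by linear_combination (zzyyyyy - 2 * hv) / 36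
    have hqq : q * (3 * q - 2 * v) = 0 := by linear_combination -(zzyyx + 2 * xxzz1) / 18
    have huv : 6 * v ^ 2 + q * v - 8 * u * (4 * c - a) = 0 := by
      linear_combination -(zzyyyy - 3 / 2 * zzxyy) / 18
    have hqv : q * v ^ 2 = 0 := by
      linear_combination 3 / 20 * (q * huv - 1 / 3 * v * hqq + 8 * u * hqm)
    have hv0 : v = 0 := by
      rw [← pow_eq_zero_iff three_ne_zero]
      linear_combination (v * huv + 8 * u * hvm - hqv) / 6
    have hq0 : q = 0 := by
      rw [← pow_eq_zero_iff two_ne_zero]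
      linear_combination hqq / 3 + 2 / 3 * q * hv0
    subst hq0 hv0
    refine ⟨by linear_combination zzyyxx - zzxyxy / 2, hdk,
      by linear_combination (zzyyxx - zzxyxy) / 2,
      by linear_combination xzyyyy / 12 - zzxyxy / 24 - (zzyyxx - zzxyxy / 2) / 4,
      by linear_combination -xxzz1 / 10, by linear_combination -xxzzy / 6,
      by linear_combination zzxyyy / 6, by linear_combination zzxyy / 8,
      by linear_combination zzxy1 / 6, by linear_combination zzyy1, by ring⟩
  · have hq := mul_left_cancel₀ hk hkv
    subst hq
    -- Everything is now expressed through `k`, `b` and `δ = (a - b)/k`. On this family the forcing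
    -- term is zero, because `1024/9 - 256/9 - 768/9 = 0`.
    obtain ⟨δ, hδ⟩ : ∃ δ, a - b = k * δ := ⟨(a - b) / k, by field_simp⟩
    obtain rfl : a = b + k * δ := by linear_combination hδ
    obtain rfl : v = 4 / 3 * k * δ ^ 2 := mul_left_cancel₀ hk (by linear_combination hkq / 3)
    obtain rfl : c = (b + 2 * (b + k * δ)) / 12 := by
      linear_combination (mul_eq_zero.mp hkm).resolve_left hk / 12
    obtain rfl : u = -4 / 3 * k * δ ^ 3 :=
      mul_left_cancel₀ hk (by linear_combination (xzyyy - zzxyyy + xxzzy / 2) / 24)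
    obtain rfl : p = -2 / 15 * k * δ ^ 3 :=
      mul_left_cancel₀ hk (by linear_combination -(zzxyx + xxzzy / 2) / 120)
    obtain rfl : s = 4 / 9 * k * δ ^ 4 :=
      mul_left_cancel₀ hk (by linear_combination -(3 / 2 * zzxyy - zzyyyy) / 360)
    obtain rfl : r = -4 / 63 * k * δ ^ 5 :=
      mul_left_cancel₀ hk (by linear_combination -(5 * zzxy1 - zzyyy) / 3360)
    refine ⟨by linear_combination zzyyxx - zzxyxy / 2, hdk,
      by linear_combination (zzyyxx - zzxyxy) / 2,
      by linear_combination xzyyyy / 12 - zzxyxy / 24 - (zzyyxx - zzxyxy / 2) / 4,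
      by linear_combination -xxzz1 / 10, by linear_combination -xxzzy / 6,
      by linear_combination zzxyyy / 6, by linear_combination zzxyy / 8,
      by linear_combination zzxy1 / 6, by linear_combination zzyy1, by ring⟩

end

/-! ### Elimination in the generic case `k₃ = k₂ = 0` -/

noncomputable section

open Polynomial

lemma coeff_C_mul_X_mul_derivative (a : ℂ) (p : ℂ[X]) (n : ℕ) :
    (C a * (X * derivative p)).coeff n = a * (n * p.coeff n) := by
  rw [coeff_C_mul]
  cases n with
  | zero => simp
  | succ n => rw [coeff_X_mul, coeff_derivative]; push_cast; ring

/-- A polynomial whose inverse has zero second derivative is constant. -/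
lemma derivative_eq_zero_of_two_mul_sq_eq {v : ℂ[X]}
    (h : 2 * derivative v ^ 2 = v * derivative (derivative v)) : derivative v = 0 := by
  rcases hd : v.natDegree with _ | e
  · rw [eq_C_of_natDegree_eq_zero hd, derivative_C]
  exfalso
  have h1 : v.natDegree ≤ e + 1 := hd.le
  have h2 : (derivative v).natDegree ≤ e := (natDegree_derivative_le v).trans (by omega)
  have h3 : (X * derivative (derivative v)).natDegree ≤ e := by
    refine natDegree_le_iff_coeff_eq_zero.mpr fun n hn => ?_
    have := coeff_C_mul_X_mul_derivative 1 (derivative v) n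
    rw [C_1, one_mul, one_mul] at this
    rw [this, natDegree_le_iff_coeff_eq_zero.mp h2 n hn, mul_zero]
  -- The extra factor `X` makes the top degrees on both sides `2e + 1`, avoiding the subtraction in
  -- the degree of the second derivative. With `d = e + 1`, leading coefficients give `2d² = d(d -
  -- 1)`, that is `d(d + 1) = 0`, which is impossible.
  have h4 : C 2 * (X * (derivative v * derivative v)) = v * (X * derivative (derivative v)) := by
    rw [show (C 2 : ℂ[X]) = 2 from map_ofNat C 2]
    linear_combination X * h
  have h5 : (C 2 * (X * (derivative v * derivative v))).coeff (e + 1 + e) =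
      (v * (X * derivative (derivative v))).coeff (e + 1 + e) := by rw [h4]
  rw [coeff_mul_add_eq_of_natDegree_le h1 h3, coeff_C_mul, show e + 1 + e = e + e + 1 by omega,
    coeff_X_mul, coeff_mul_add_eq_of_natDegree_le h2 h2] at h5
  have h6 := coeff_C_mul_X_mul_derivative 1 (derivative v) e
  rw [C_1, one_mul, one_mul] at h6
  rw [h6, coeff_derivative] at h5
  have h7 : v.coeff (e + 1) ≠ 0 := by
    rw [← hd]
    exact leadingCoeff_ne_zero.mpr fun h => by simp [h] at hd
  have h8 : v.coeff (e + 1) ^ 2 * (((e + 1) * (e + 2) : ℕ) : ℂ) = 0 := by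
    push_cast
    linear_combination h5
  rcases mul_eq_zero.mp h8 with h | h
  · exact h7 (pow_eq_zero_iff two_ne_zero |>.mp h)
  · rw [Nat.cast_eq_zero] at h
    exact absurd h (by positivity)

lemma eq_zero_of_derivative_derivative {v : ℂ[X]} (h : derivative (derivative v) = 0)
    (h0 : v.coeff 0 = 0) (h1 : v.coeff 1 = 0) : v = 0 := by
  ext n
  rcases n with _ | _ | n
  · exact h0
  · exact h1
  · have := congrArg (fun p => p.coeff n) h
    simp only [coeff_derivative, coeff_zero] at this
    exact (mul_eq_zero.mp ((mul_eq_zero.mp this).resolve_right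
      (Nat.cast_add_one_ne_zero n))).resolve_right (Nat.cast_add_one_ne_zero (n + 1))

/-- Each of `p`, `v`, `u` has an equation for the first and one for the second `z`-derivative of its
`τ`-derivative. Their compatibility gives differential relations in `z` that force `q = v = 0`; the
surviving equations are then read off coefficientwise. -/
lemma reducedWDVV_generic {a b c da db dc : ℂ} {p q r s u v dp dq dr ds du dv : ℂ[X]}
    (R : ReducedWDVV 0 0 a b c p q r s u v 0 0 da db dc dp dq dr ds du dv)
    (hq0 : q.coeff 0 = 0) (hq1 : q.coeff 1 = 0) (hv0 : v.coeff 0 = 0) (hv1 : v.coeff 1 = 0) :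
    a = b ∧ da = db ∧ db = -2 * b ^ 2 ∧ dc = 1 / 2 * b ^ 2 - 4 * b * c ∧ q = 0 ∧ v = 0 ∧
      (∀ n : ℕ, dp.coeff (n + 1) = -2 * b * n * p.coeff (n + 1)) ∧
      (∀ n : ℕ, ds.coeff (n + 1) = -2 * b * n * s.coeff (n + 1)) ∧
      (∀ n : ℕ, du.coeff (n + 1) = -2 * b * (n + 1) * u.coeff (n + 1)) ∧
      (∀ n : ℕ, ((n : ℂ) + 1) * (n + 2) * (dr.coeff (n + 2) + 2 * b * n * r.coeff (n + 2)) =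
        (4 * derivative u ^ 2 - 2 * derivative u * derivative (derivative p)).coeff n) := by
  have e1 := R.xxzz_x 1
  have e2 := R.xxyy_one 1
  have e3 := R.xxzz_yy 1
  have e4 := R.xzyy_yy 1
  have e5 := R.zzyy_xx
  simp at e1 e2 e3 e4
  obtain rfl : a = b := by
    rw [← sub_eq_zero, ← pow_eq_zero_iff two_ne_zero]
    linear_combination e2 / 4 - e1 / 16
  have hdb : db = -2 * a ^ 2 := by linear_combination -e3 / 2
  have P1 : 2 * derivative dp = -(4 * (C a * (X * derivative (derivative p)))) -
      derivative q * derivative q := Polynomial.funext fun z => by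
    have := R.xxzz_one z
    simp at this ⊢
    linear_combination -this
  have P2 : derivative (derivative dp) = derivative (derivative q) * (2 * derivative q - 6 * v) -
      2 * (C a * derivative (derivative p)) -
      2 * (C a * (X * derivative (derivative (derivative p)))) := Polynomial.funext fun z => by
    have := R.zzyy_x z
    simp at this ⊢
    linear_combination this
  -- Differentiating `P1` and substituting `P2` leaves `6 q'' (q' - 2v) = 0`.
  have Q1 : derivative q = 2 * v ∨ derivative (derivative q) = 0 := by
    have h := congrArg derivative P1
    simp only [derivative_sub, derivative_neg, derivative_mul, derivative_C, derivative_X,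
      derivative_ofNat] at h
    rw [P2] at h
    have h3 : (6 : ℂ[X]) * (derivative (derivative q) * (derivative q - 2 * v)) = 0 := by
      linear_combination h
    rcases mul_eq_zero.mp ((mul_eq_zero.mp h3).resolve_left (by norm_num)) with h4 | h4
    · exact Or.inr h4
    · exact Or.inl (sub_eq_zero.mp h4)
  have V1 : derivative dv = -(2 * (C a * (X * derivative (derivative v)))) -
      4 * (C a * derivative v) := Polynomial.funext fun z => by
    have := R.zzxy_yy z
    simp at this ⊢
    linear_combination this / 3
  have V2 : derivative (derivative dv) = (12 * C a - 72 * C c) * derivative (derivative v) -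
      2 * (C a * (X * derivative (derivative (derivative v)))) := Polynomial.funext fun z => by
    have := R.zzyy_yyy z
    simp at this ⊢
    linear_combination this
  have V3 : v = 0 ∨ a = 4 * c := by
    have h := congrArg derivative V1
    simp only [derivative_sub, derivative_neg, derivative_mul, derivative_C, derivative_X,
      derivative_ofNat] at h
    rw [V2] at h
    have h3 : (18 * (C a - 4 * C c)) * derivative (derivative v) = 0 := by
      linear_combination h
    rcases mul_eq_zero.mp h3 with h4 | h4
    · right
      have h5 := (mul_eq_zero.mp h4).resolve_left (by norm_num)
      have h6 := congrArg (eval 0) h5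
      simp at h6
      linear_combination h6
    · exact Or.inl (eq_zero_of_derivative_derivative h4 hv0 hv1)
  have U1 : derivative du = -(2 * (C a * (X * derivative (derivative u)))) -
      2 * (C a * derivative u) - 3 * (derivative q * derivative v) := Polynomial.funext fun z => by
    have := R.zzxy_y z
    simp at this ⊢
    linear_combination this / 2
  have U2 : derivative (derivative du) = (8 * C a - 48 * C c) * derivative (derivative u) +
      3 * (derivative (derivative v) * (2 * derivative q - 6 * v)) +
      6 * (derivative v * (6 * derivative v - derivative (derivative q))) -
      2 * (C a * (X * derivative (derivative (derivative u)))) := Polynomial.funext fun z => by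
    have := R.zzyy_yy z
    simp at this ⊢
    linear_combination this
  have U3 : 12 * (C a - 4 * C c) * derivative (derivative u) +
      9 * (derivative q * derivative (derivative v)) -
      3 * (derivative (derivative q) * derivative v) + 36 * derivative v ^ 2 -
      18 * (v * derivative (derivative v)) = 0 := by
    have h := congrArg derivative U1
    simp only [derivative_sub, derivative_neg, derivative_mul, derivative_C, derivative_X,
      derivative_ofNat] at h
    rw [U2] at h
    linear_combination h
  -- If `a = 4c`, `U3` becomes `30 v'² = 0` for `q' = 2v`, and `2v'² = v v''` for `q = 0`. Either
  -- way `v` is constant, and it vanishes because its constant coefficient does.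
  have hv : v = 0 := by
    rcases V3 with hv | hac
    · exact hv
    have hac' : C a - 4 * C c = 0 := by rw [hac, C_mul, map_ofNat C 4, sub_self]
    rw [hac', mul_zero, zero_mul] at U3
    refine eq_zero_of_derivative_derivative ?_ hv0 hv1
    have : derivative v = 0 := by
      rcases Q1 with h | h
      · have h' : derivative (derivative q) = 2 * derivative v := by rw [h]; simp
        rw [h', h] at U3
        have : (30 : ℂ[X]) * derivative v ^ 2 = 0 := by linear_combination U3
        simpa using this
      · obtain rfl := eq_zero_of_derivative_derivative h hq0 hq1
        refine derivative_eq_zero_of_two_mul_sq_eq ?_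
        refine mul_left_cancel₀ (show (18 : ℂ[X]) ≠ 0 by norm_num) ?_
        simp at U3
        linear_combination U3
    rw [this, derivative_zero]
  subst hv
  have hq : q = 0 := by
    refine eq_zero_of_derivative_derivative ?_ hq0 hq1
    rcases Q1 with h | h
    · simp [h]
    · exact h
  subst hq
  have hcoeff : ∀ {n : ℕ}, (n : ℂ) + 1 ≠ 0 := fun {n} => by exact_mod_cast Nat.succ_ne_zero n
  refine ⟨rfl, by linear_combination -e1 / 8 - hdb, hdb, by linear_combination e4 / 12 - hdb / 12,
    rfl, rfl, ?_, ?_, ?_, ?_⟩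
  · intro n
    have h := congrArg (fun p => p.coeff n) P1
    simp only [derivative_zero, mul_zero, sub_zero, coeff_ofNat_mul, coeff_neg,
      coeff_C_mul_X_mul_derivative, coeff_derivative] at h
    refine mul_right_cancel₀ hcoeff (b := (n : ℂ) + 1) ?_
    linear_combination h / 2
  · intro n
    have S1 : derivative ds = -(2 * (C a * (X * derivative (derivative s)))) :=
      Polynomial.funext fun z => by
        have := R.zzxy_one z
        simp at this ⊢
        linear_combination this
    have h := congrArg (fun p => p.coeff n) S1
    simp only [coeff_ofNat_mul, coeff_neg,
      coeff_C_mul_X_mul_derivative, coeff_derivative] at h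
    refine mul_right_cancel₀ hcoeff (b := (n : ℂ) + 1) ?_
    linear_combination h
  · intro n
    have h := congrArg (fun p => p.coeff n) U1
    simp only [derivative_zero, mul_zero, sub_zero, coeff_sub, coeff_neg, coeff_ofNat_mul,
      coeff_C_mul_X_mul_derivative] at h
    simp only [coeff_C_mul, coeff_derivative] at h
    refine mul_right_cancel₀ hcoeff (b := (n : ℂ) + 1) ?_
    linear_combination h
  · intro n
    have R1 : derivative (derivative dr) + 2 * (C a * (X * derivative (derivative (derivative r))))
        = 4 * derivative u ^ 2 - 2 * derivative u * derivative (derivative p) :=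
      Polynomial.funext fun z => by
        have := R.zzyy_one z
        simp at this ⊢
        linear_combination this
    rw [← R1]
    simp only [coeff_add, coeff_ofNat_mul, coeff_C_mul_X_mul_derivative, coeff_derivative]
    push_cast
    ring

end

noncomputable section

/-! ### The second order equations satisfied by the coefficients -/

/-- The equation `h'' = (w + 1) γ h' - w (w + 1) γ² h / 4` on `U`, which is the Euler equation of
weight `w` if `γ = -2 / (τ - c)` and `h'' = 0` if `γ = 0`. -/
def ModularEquation (γ : ℂ → ℂ) (w : ℂ) (h : ℂ → ℂ) (U : Set ℂ) : Prop :=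
  ∀ τ ∈ U, deriv (deriv h) τ =
    (w + 1) * γ τ * deriv h τ - 1 / 4 * w * (w + 1) * γ τ ^ 2 * h τ

/-- Differentiate `h' = (w/2) γ h + κ` and eliminate `κ = h' - (w/2) γ h` by means of its own
equation. The forcing term may be zero, which covers the first-order case. -/
lemma modularEquation_of_hasDerivAt {U : Set ℂ} (hU : IsOpen U) {γ h κ : ℂ → ℂ} {w : ℂ}
    (hγ : ∀ τ ∈ U, HasDerivAt γ (1 / 2 * γ τ ^ 2) τ)
    (hh : ∀ τ ∈ U, HasDerivAt h (1 / 2 * w * γ τ * h τ + κ τ) τ)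
    (hκ : ∀ τ ∈ U, HasDerivAt κ (1 / 2 * (w + 2) * γ τ * κ τ) τ) : ModularEquation γ w h U := by
  intro τ hτ
  have h1 : deriv h =ᶠ[nhds τ] fun τ => 1 / 2 * w * γ τ * h τ + κ τ :=
    Filter.eventuallyEq_of_mem (hU.mem_nhds hτ) fun x hx => (hh x hx).deriv
  have h2 := (((hγ τ hτ).const_mul (1 / 2 * w)).mul (hh τ hτ)).add (hκ τ hτ)
  rw [h1.deriv_eq, h1.self_of_nhds]
  refine HasDerivAt.deriv (h2.congr_deriv ?_)
  ring

lemma deriv_eq_zero_on {U : Set ℂ} (hU : IsOpen U) {f : ℂ → ℂ} (hf : ∀ τ ∈ U, f τ = 0) :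
    ∀ τ ∈ U, deriv f τ = 0 :=
  iterate_deriv_eq_zero hU hf 1

section
variable {U : Set ℂ} (hU : IsOpen U) {g : (ℕ × ℕ × ℕ) →₀ (ℂ → ℂ)}
  (hg : ∀ α, DifferentiableOn ℂ (g α) U)
include hU hg

lemma hasDerivAt_coeff (α : ℕ × ℕ × ℕ) {τ : ℂ} (hτ : τ ∈ U) :
    HasDerivAt (g α) (deriv (g α) τ) τ :=
  ((hg α).differentiableAt (hU.mem_nhds hτ)).hasDerivAt

lemma modularEquation_remainder {γ κ : ℂ → ℂ} (hγ : ∀ τ ∈ U, HasDerivAt γ (1 / 2 * γ τ ^ 2) τ)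
    {α : ℕ × ℕ × ℕ} (hα : ∀ τ ∈ U, deriv (g α) τ + 1 / 16 * pivotCoeff α * (1 / 2 * γ τ ^ 2) =
      1 / 2 * weight α * γ τ * (g α τ + 1 / 16 * pivotCoeff α * γ τ) + κ τ)
    (hκ : ∀ τ ∈ U, HasDerivAt κ (1 / 2 * (weight α + 2) * γ τ * κ τ) τ) :
    ModularEquation γ (weight α) (remainder g γ α) U := by
  refine modularEquation_of_hasDerivAt hU hγ (fun τ hτ => ?_) hκ
  exact ((hasDerivAt_coeff hU hg α hτ).add
    ((hγ τ hτ).const_mul (1 / 16 * pivotCoeff α))).congr_deriv (hα τ hτ)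

lemma modularEquation_remainder_of_first_order {γ : ℂ → ℂ}
    (hγ : ∀ τ ∈ U, HasDerivAt γ (1 / 2 * γ τ ^ 2) τ)
    {α : ℕ × ℕ × ℕ} (hα : ∀ τ ∈ U, deriv (g α) τ + 1 / 16 * pivotCoeff α * (1 / 2 * γ τ ^ 2) =
      1 / 2 * weight α * γ τ * (g α τ + 1 / 16 * pivotCoeff α * γ τ)) :
    ModularEquation γ (weight α) (remainder g γ α) U :=
  modularEquation_remainder hU hg (κ := fun _ => 0) hγ (fun τ hτ => by rw [hα τ hτ, add_zero])
    (fun τ _ => (hasDerivAt_const τ 0).congr_deriv (by simp))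

/-- The pivot points solve the Frobenius equation for every `σ`, so off its solutions the remainder
is just `g α`, which vanishes on `U`. -/
lemma modularEquation_remainder_of_notMem {σ : ℝ} {γ : ℂ → ℂ}
    (hγ : ∀ τ ∈ U, HasDerivAt γ (1 / 2 * γ τ ^ 2) τ)
    (hz : ∀ α, α ∉ frobeniusSolutions σ → ∀ τ ∈ U, g α τ = 0) {α : ℕ × ℕ × ℕ}
    (hα : α ∉ frobeniusSolutions σ) : ModularEquation γ (weight α) (remainder g γ α) U := by
  have hp : pivotCoeff α = 0 := by
    by_contra h
    have h' : α ∈ pivotPoints := h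
    rw [pivotPoints_eq] at h'
    apply hα
    simp only [Set.mem_insert_iff, Set.mem_singleton_iff] at h'
    rcases h' with rfl | rfl | rfl <;> norm_num [frobeniusSolutions] <;> ring
  refine modularEquation_remainder_of_first_order hU hg hγ fun τ hτ => ?_
  rw [deriv_eq_zero_on hU (hz α hα) τ hτ, hz α hα τ hτ, hp]
  ring

end

lemma hasShape_of_lt {σ : ℝ} (h0 : 0 < σ) (h1 : σ < 1 / 2) {U : Set ℂ} (hU : IsOpen U)
    {g : (ℕ × ℕ × ℕ) →₀ (ℂ → ℂ)} (hz : ∀ α, α ∉ frobeniusSolutions σ → ∀ τ ∈ U, g α τ = 0)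
    {τ : ℂ} (hτ : τ ∈ U) (n : ℕ) : HasShape fun α => deriv^[n] (g α) τ := by
  constructor
  intro a b c n1 n2 n3 n4 n5 n6 n7 n8 n9 n10 n11
  refine iterate_deriv_eq_zero hU (hz _ fun h => ?_) n τ hτ
  have key : ∀ {c' : ℕ × ℕ × ℕ} {P : Prop}, (a, b, c) = c' →
      (a = c'.1 → b = c'.2.1 → c = c'.2.2 → P) → P := by
    rintro _ P rfl h
    exact h rfl rfl rfl
  rcases frobeniusSolutions_cases h0 h1 h with (h | h | h) | ⟨h, -⟩ | ⟨h, -⟩ | ⟨c, hc, h, -⟩ |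
    ⟨c, hc, h, -⟩ | ⟨c, hc, h, -⟩ | ⟨c, hc, h, -⟩ | ⟨c, hc, h, -⟩ | ⟨c, hc, h, -⟩
  · exact n1 h
  · exact n2 h
  · exact n3 h
  · exact n4 h
  · exact n5 h
  · exact key h fun h1 h2 h3 => n6 ⟨h1, h2, h3.symm ▸ hc⟩
  · exact key h fun h1 h2 h3 => n7 ⟨h1, h2, h3.symm ▸ hc⟩
  · exact key h fun h1 h2 h3 => n8 ⟨h1, h2, h3.symm ▸ hc⟩
  · exact key h fun h1 h2 h3 => n9 ⟨h1, h2, h3.symm ▸ hc⟩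
  · exact key h fun h1 h2 h3 => n10 ⟨h1, h2, h3.symm ▸ hc⟩
  · exact key h fun h1 h2 h3 => n11 ⟨h1, h2, h3.symm ▸ hc⟩

section
variable {U : Set ℂ} (hU : IsOpen U) {g : (ℕ × ℕ × ℕ) →₀ (ℂ → ℂ)} {N : ℕ}
  (hN : g.support ⊆ box N) {a b : ℕ}
include hU hN

open Polynomial in
lemma colPoly_eq_monomial {c : ℕ} (h : ∀ c', c' ≠ c → ∀ τ ∈ U, g (a, b, c') τ = 0) (n : ℕ) {τ : ℂ}
    (hτ : τ ∈ U) : colPoly N g n τ a b = C (deriv^[n] (g (a, b, c)) τ) * X ^ c := by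
  ext c'
  rw [coeff_colPoly hN, coeff_C_mul_X_pow]
  split_ifs with hc
  · rw [hc]
  · exact iterate_deriv_eq_zero hU (h c' hc) n τ hτ

lemma colPoly_eq_zero (h : ∀ c, ∀ τ ∈ U, g (a, b, c) τ = 0) (n : ℕ) {τ : ℂ}
    (hτ : τ ∈ U) : colPoly N g n τ a b = 0 := by
  ext c
  rw [coeff_colPoly hN, Polynomial.coeff_zero]
  exact iterate_deriv_eq_zero hU (h c) n τ hτ

end

/-- There is a pivot term `γ` satisfying the Riccati equation for which all remainders satisfy the
modular equation. -/
def HasPivotTerm (σ : ℝ) (U : Set ℂ) (g : (ℕ × ℕ × ℕ) →₀ (ℂ → ℂ)) : Prop :=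
  ∃ γ : ℂ → ℂ,
    ((∀ τ ∈ U, γ τ = -4 * g (1, 2, 1) τ) ∨
      (σ = 1 / 4 ∧ ∀ τ ∈ U, γ τ = 4 * g (1, 2, 1) τ - 8 * g (2, 0, 2) τ)) ∧
    (∀ τ ∈ U, HasDerivAt γ (1 / 2 * γ τ ^ 2) τ) ∧
    ∀ α, ModularEquation γ (weight α) (remainder g γ α) U

section
variable {σ : ℝ} {U : Set ℂ} (hU : IsOpen U) {g : (ℕ × ℕ × ℕ) →₀ (ℂ → ℂ)}
  (hg : ∀ α, DifferentiableOn ℂ (g α) U)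
  (hz : ∀ α, α ∉ frobeniusSolutions σ → ∀ τ ∈ U, g α τ = 0)
  (hW : SolvesWDVV (prepotential g) (regionOver U))
include hU hg hz hW

/-- For this `σ` every column has at most one admissible power of `z`, so `reducedWDVV_third`
applies at each `τ`. Only `z⁶` has a forcing term. -/
lemma hasPivotTerm_third (hσ : σ = 1 / 3) : HasPivotTerm σ U g := by
  obtain ⟨N, h5, hN⟩ := exists_subset_box g.support
  -- The admissible exponent `x` is taken real because it is a half-integer for odd `b`, and then
  -- the whole column vanishes.
  have hc : ∀ {a b c : ℕ} {x : ℝ}, 2 * (a : ℝ) / 3 + b / 2 + x / 3 = 2 → (c : ℝ) ≠ x →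
      ∀ τ ∈ U, g (a, b, c) τ = 0 := by
    intro a b c x h1 h2
    refine hz _ fun h => h2 ?_
    simp only [frobeniusSolutions, Set.mem_ofPred_eq, hσ] at h
    linarith
  have main := fun (τ : ℂ) (hτ : τ ∈ U) => by
    have R := reducedWDVV_of_solvesWDVV hU hg hW h5 hN hτ
      (hasShape_of_lt (σ := σ) (by rw [hσ]; norm_num) (by rw [hσ]; norm_num) hU hz hτ)
    have h21 : ∀ τ ∈ U, g (2, 1, 0) τ = 0 := hc (x := 1 / 2) (by norm_num) (by norm_num)
    have h10 : ∀ c, c ≠ 4 → ∀ τ ∈ U, g (1, 0, c) τ = 0 := fun c h =>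
      hc (x := 4) (by norm_num) (by exact_mod_cast h)
    have h11 : ∀ c, ∀ τ ∈ U, g (1, 1, c) τ = 0 := fun c =>
      hc (x := 5 / 2) (by norm_num) fun h => by
        have : (2 * c : ℝ) = 5 := by linarith
        have : 2 * c = 5 := by exact_mod_cast this
        omega
    have h00 : ∀ c, c ≠ 6 → ∀ τ ∈ U, g (0, 0, c) τ = 0 := fun c h =>
      hc (x := 6) (by norm_num) (by exact_mod_cast h)
    have h01 : ∀ c, ∀ τ ∈ U, g (0, 1, c) τ = 0 := fun c =>
      hc (x := 9 / 2) (by norm_num) fun h => by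
        have : (2 * c : ℝ) = 9 := by linarith
        have : 2 * c = 9 := by exact_mod_cast this
        omega
    have h02 : ∀ c, c ≠ 3 → ∀ τ ∈ U, g (0, 2, c) τ = 0 := fun c h =>
      hc (x := 3) (by norm_num) (by exact_mod_cast h)
    have h03 : ∀ c, ∀ τ ∈ U, g (0, 3, c) τ = 0 := fun c =>
      hc (x := 3 / 2) (by norm_num) fun h => by
        have : (2 * c : ℝ) = 3 := by linarith
        have : 2 * c = 3 := by exact_mod_cast this
        omega
    rw [h21 τ hτ, deriv_eq_zero_on hU h21 τ hτ, colPoly_eq_monomial hU hN h10 0 hτ,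
      colPoly_eq_monomial hU hN h10 1 hτ, colPoly_eq_zero hU hN h11 0 hτ,
      colPoly_eq_zero hU hN h11 1 hτ, colPoly_eq_monomial hU hN h00 0 hτ,
      colPoly_eq_monomial hU hN h00 1 hτ, colPoly_eq_zero hU hN h01 0 hτ,
      colPoly_eq_zero hU hN h01 1 hτ, colPoly_eq_monomial hU hN h02 0 hτ,
      colPoly_eq_monomial hU hN h02 1 hτ, colPoly_eq_zero hU hN h03 0 hτ,
      colPoly_eq_zero hU hN h03 1 hτ] at R
    exact reducedWDVV_third R
  simp only [Function.iterate_zero, id, Function.iterate_one] at main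
  have D := fun α (τ : ℂ) (hτ : τ ∈ U) => hasDerivAt_coeff hU hg α hτ
  have hγ : ∀ τ ∈ U, HasDerivAt (fun τ => -4 * g (1, 2, 1) τ)
      (1 / 2 * (-4 * g (1, 2, 1) τ) ^ 2) τ := fun τ hτ => by
    refine ((D (1, 2, 1) τ hτ).const_mul (-4)).congr_deriv ?_
    rw [(main τ hτ).1]; ring
  refine ⟨_, Or.inl fun τ _ => rfl, hγ, fun α => ?_⟩
  by_cases hα : α ∈ frobeniusSolutions σ
  swap
  · exact modularEquation_remainder_of_notMem hU hg hγ hz hα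
  have hfirst := fun α => modularEquation_remainder_of_first_order hU hg hγ (α := α)
  have hcast : ∀ {c d : ℕ} {y : ℝ}, σ * c = y → y = d / 3 → c = d := by
    intro c d y h1 h2
    have : (c : ℝ) = d := by rw [hσ] at h1; linarith
    exact_mod_cast this
  rcases frobeniusSolutions_cases (by rw [hσ]; norm_num) (by rw [hσ]; norm_num) hα with
    (rfl | rfl | rfl) | ⟨rfl, -⟩ | ⟨rfl, h⟩ | ⟨c, -, rfl, h⟩ | ⟨c, -, rfl, h⟩ | ⟨c, -, rfl, h⟩ |
    ⟨c, -, rfl, h⟩ | ⟨c, -, rfl, h⟩ | ⟨c, -, rfl, h⟩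
  · refine hfirst _ fun τ hτ => ?_
    obtain ⟨m1, m2, m3, m4, m5, m6, m7⟩ := main τ hτ
    norm_num [pivotCoeff_eq, weight]
    linear_combination m3 + m1
  · refine hfirst _ fun τ hτ => ?_
    obtain ⟨m1, m2, m3, m4, m5, m6, m7⟩ := main τ hτ
    norm_num [pivotCoeff_eq, weight]
    linear_combination m1
  · refine hfirst _ fun τ hτ => ?_
    obtain ⟨m1, m2, m3, m4, m5, m6, m7⟩ := main τ hτ
    norm_num [pivotCoeff_eq, weight]
    linear_combination m4
  · refine hfirst _ fun τ hτ => ?_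
    obtain ⟨m1, m2, m3, m4, m5, m6, m7⟩ := main τ hτ
    norm_num [pivotCoeff_eq, weight]
    linear_combination m2
  · rw [hσ] at h; norm_num at h
  · obtain rfl : c = 4 := by
      have : (c : ℝ) = (4 : ℕ) := by rw [hσ] at h; push_cast; linarith
      exact_mod_cast this
    refine hfirst _ fun τ hτ => ?_
    obtain ⟨m1, m2, m3, m4, m5, m6, m7⟩ := main τ hτ
    norm_num [pivotCoeff_eq, weight]
    linear_combination m5
  · exfalso
    have : (2 * c : ℝ) = 5 := by rw [hσ] at h; linarith
    have : 2 * c = 5 := by exact_mod_cast this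
    omega
  · obtain rfl : c = 6 := hcast h (by norm_num)
    refine modularEquation_remainder hU hg hγ (κ := fun τ =>
      (36 * g (0, 2, 3) τ ^ 2 - 72 * (g (1, 0, 4) τ * g (0, 2, 3) τ)) / 30) (fun τ hτ => ?_)
      fun τ hτ => ?_
    · obtain ⟨m1, m2, m3, m4, m5, m6, m7⟩ := main τ hτ
      norm_num [pivotCoeff_eq, weight]
      linear_combination m7 / 30
    · obtain ⟨m1, m2, m3, m4, m5, m6, m7⟩ := main τ hτ
      refine (((((D (0, 2, 3) τ hτ).pow 2).const_mul 36).sub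
        (((D (1, 0, 4) τ hτ).mul (D (0, 2, 3) τ hτ)).const_mul 72)).div_const 30).congr_deriv ?_
      rw [m5, m6]
      norm_num [weight]
      ring
  · exfalso
    have : (2 * c : ℝ) = 9 := by rw [hσ] at h; linarith
    have : 2 * c = 9 := by exact_mod_cast this
    omega
  · obtain rfl : c = 3 := hcast h (by norm_num)
    refine hfirst _ fun τ hτ => ?_
    obtain ⟨m1, m2, m3, m4, m5, m6, m7⟩ := main τ hτ
    norm_num [pivotCoeff_eq, weight]
    linear_combination m6
  · exfalso
    have : (2 * c : ℝ) = 3 := by rw [hσ] at h; linarith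
    have : 2 * c = 3 := by exact_mod_cast this
    omega

end

end

/-! ### The pivot term for `σ = 1/4` and for generic `σ` -/

noncomputable section

section
variable {σ : ℝ} {U : Set ℂ} (hU : IsOpen U) {g : (ℕ × ℕ × ℕ) →₀ (ℂ → ℂ)}
  (hg : ∀ α, DifferentiableOn ℂ (g α) U)
  (hz : ∀ α, α ∉ frobeniusSolutions σ → ∀ τ ∈ U, g α τ = 0)
  (hW : SolvesWDVV (prepotential g) (regionOver U))
include hU hg hz hW

lemma hasPivotTerm_quarter (hσ : σ = 1 / 4) : HasPivotTerm σ U g := by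
  obtain ⟨N, h5, hN⟩ := exists_subset_box g.support
  have hc : ∀ {a b : ℕ} (d : ℕ), 3 * (a : ℝ) / 4 + b / 2 + d / 4 = 2 → ∀ c, c ≠ d →
      ∀ τ ∈ U, g (a, b, c) τ = 0 := by
    intro a b d h1 c h2
    refine hz _ fun h => h2 ?_
    simp only [frobeniusSolutions, Set.mem_ofPred_eq, hσ] at h
    have : (c : ℝ) = d := by linarith
    exact_mod_cast this
  have h30 : ∀ τ ∈ U, g (3, 0, 0) τ = 0 := hz _ (by norm_num [frobeniusSolutions, hσ])
  have h10 := hc (a := 1) (b := 0) 5 (by norm_num)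
  have h11 := hc (a := 1) (b := 1) 3 (by norm_num)
  have h00 := hc (a := 0) (b := 0) 8 (by norm_num)
  have h01 := hc (a := 0) (b := 1) 6 (by norm_num)
  have h02 := hc (a := 0) (b := 2) 4 (by norm_num)
  have h03 := hc (a := 0) (b := 3) 2 (by norm_num)
  have main := fun (τ : ℂ) (hτ : τ ∈ U) => by
    have R := reducedWDVV_of_solvesWDVV hU hg hW h5 hN hτ
      (hasShape_of_lt (σ := σ) (by rw [hσ]; norm_num) (by rw [hσ]; norm_num) hU hz hτ)
    rw [h30 τ hτ, deriv_eq_zero_on hU h30 τ hτ, colPoly_eq_monomial hU hN h10 0 hτ,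
      colPoly_eq_monomial hU hN h10 1 hτ, colPoly_eq_monomial hU hN h11 0 hτ,
      colPoly_eq_monomial hU hN h11 1 hτ, colPoly_eq_monomial hU hN h00 0 hτ,
      colPoly_eq_monomial hU hN h00 1 hτ, colPoly_eq_monomial hU hN h01 0 hτ,
      colPoly_eq_monomial hU hN h01 1 hτ, colPoly_eq_monomial hU hN h02 0 hτ,
      colPoly_eq_monomial hU hN h02 1 hτ, colPoly_eq_monomial hU hN h03 0 hτ,
      colPoly_eq_monomial hU hN h03 1 hτ] at R
    exact reducedWDVV_quarter R
  simp only [Function.iterate_zero, id, Function.iterate_one] at main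
  have D := fun α (τ : ℂ) (hτ : τ ∈ U) => hasDerivAt_coeff hU hg α hτ
  have hγ : ∀ τ ∈ U, HasDerivAt (fun τ => 4 * g (1, 2, 1) τ - 8 * g (2, 0, 2) τ)
      (1 / 2 * (4 * g (1, 2, 1) τ - 8 * g (2, 0, 2) τ) ^ 2) τ := fun τ hτ => by
    refine (((D (1, 2, 1) τ hτ).const_mul 4).sub ((D (2, 0, 2) τ hτ).const_mul 8)).congr_deriv ?_
    linear_combination -4 * (main τ hτ).1
  refine ⟨_, Or.inr ⟨hσ, fun τ _ => rfl⟩, hγ, fun α => ?_⟩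
  by_cases hα : α ∈ frobeniusSolutions σ
  swap
  · exact modularEquation_remainder_of_notMem hU hg hγ hz hα
  have hfirst := fun α => modularEquation_remainder_of_first_order hU hg hγ (α := α)
  have hcast : ∀ {c : ℕ} (d : ℕ) {x y : ℝ}, σ * (c - x) = y → y = (d - x) / 4 → c = d := by
    intro c d x y h1 h2
    have : (c : ℝ) = d := by rw [hσ] at h1; linarith
    exact_mod_cast this
  have hcast0 : ∀ {c : ℕ} (d : ℕ) {y : ℝ}, σ * c = y → y = d / 4 → c = d := by
    intro c d y h1 h2
    have : (c : ℝ) = d := by rw [hσ] at h1; linarith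
    exact_mod_cast this
  rcases frobeniusSolutions_cases (by rw [hσ]; norm_num) (by rw [hσ]; norm_num) hα with
    (rfl | rfl | rfl) | ⟨rfl, h⟩ | ⟨rfl, -⟩ | ⟨c, -, rfl, h⟩ | ⟨c, -, rfl, h⟩ | ⟨c, -, rfl, h⟩ |
    ⟨c, -, rfl, h⟩ | ⟨c, -, rfl, h⟩ | ⟨c, -, rfl, h⟩
  · refine hfirst _ fun τ hτ => ?_
    obtain ⟨m1, -, m3, -⟩ := main τ hτ
    norm_num [pivotCoeff_eq, weight]
    linear_combination m1 - m3
  · refine hfirst _ fun τ hτ => ?_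
    obtain ⟨m1, -, m3, -⟩ := main τ hτ
    norm_num [pivotCoeff_eq, weight]
    linear_combination m1 - 2 * m3
  · refine hfirst _ fun τ hτ => ?_
    obtain ⟨m1, -, -, m4, -⟩ := main τ hτ
    norm_num [pivotCoeff_eq, weight]
    linear_combination m4 + m1 / 4
  · rw [hσ] at h; norm_num at h
  · refine hfirst _ fun τ hτ => ?_
    obtain ⟨-, m2, -⟩ := main τ hτ
    norm_num [pivotCoeff_eq, weight]
    linear_combination m2
  · obtain rfl : c = 5 := hcast 5 h (by norm_num)
    refine hfirst _ fun τ hτ => ?_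
    obtain ⟨-, -, -, -, m5, -⟩ := main τ hτ
    norm_num [pivotCoeff_eq, weight]
    linear_combination m5
  · obtain rfl : c = 3 := hcast 3 h (by norm_num)
    refine hfirst _ fun τ hτ => ?_
    obtain ⟨-, -, -, -, -, m6, -⟩ := main τ hτ
    norm_num [pivotCoeff_eq, weight]
    linear_combination m6
  · obtain rfl : c = 8 := hcast0 8 h (by norm_num)
    refine modularEquation_remainder hU hg hγ (κ := fun τ =>
      (64 * g (0, 2, 4) τ ^ 2 - 160 * (g (0, 2, 4) τ * g (1, 0, 5) τ) +
        1344 * ((g (2, 0, 2) τ - g (1, 2, 1) τ) * g (0, 0, 8) τ)) / 56) (fun τ hτ => ?_)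
      fun τ hτ => ?_
    · obtain ⟨-, -, -, -, -, -, -, -, -, m10, -⟩ := main τ hτ
      norm_num [pivotCoeff_eq, weight]
      linear_combination m10 / 56
    · obtain ⟨-, -, m3, -, m5, -, -, m8, -, m10, m11⟩ := main τ hτ
      refine ((((((D (0, 2, 4) τ hτ).pow 2).const_mul 64).sub
        (((D (0, 2, 4) τ hτ).mul (D (1, 0, 5) τ hτ)).const_mul 160)).add
        ((((D (2, 0, 2) τ hτ).sub (D (1, 2, 1) τ hτ)).mul (D (0, 0, 8) τ hτ)).const_mul
          1344)).div_const 56).congr_deriv ?_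
      rw [m5, m8]
      norm_num [weight]
      -- Differentiating `(a - b) r` produces `(a - b) κ` besides the homogeneous part; `m11` makes
      -- it vanish.
      linear_combination 24 * g (0, 0, 8) τ * m3 +
        3 / 7 * (g (2, 0, 2) τ - g (1, 2, 1) τ) * m10 + 3 / 7 * m11
  · obtain rfl : c = 6 := hcast0 6 h (by norm_num)
    refine hfirst _ fun τ hτ => ?_
    obtain ⟨-, -, -, -, -, -, -, -, m9, -⟩ := main τ hτ
    norm_num [pivotCoeff_eq, weight]
    linear_combination m9
  · obtain rfl : c = 4 := hcast0 4 h (by norm_num)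
    refine hfirst _ fun τ hτ => ?_
    obtain ⟨-, -, -, -, -, -, -, m8, -⟩ := main τ hτ
    norm_num [pivotCoeff_eq, weight]
    linear_combination m8
  · obtain rfl : c = 2 := hcast0 2 h (by norm_num)
    refine hfirst _ fun τ hτ => ?_
    obtain ⟨-, -, -, -, -, -, m7, -⟩ := main τ hτ
    norm_num [pivotCoeff_eq, weight]
    linear_combination m7

/-- Neither `x³` nor `x² y` occurs, so `reducedWDVV_generic` applies to the full columns and the
numerical value of `σ` plays no further role. -/
lemma hasPivotTerm_generic (h0 : 0 < σ) (h1 : σ < 1 / 2) (h3 : σ ≠ 1 / 3) (h4 : σ ≠ 1 / 4) :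
    HasPivotTerm σ U g := by
  obtain ⟨N, h5, hN⟩ := exists_subset_box g.support
  have h30 : ∀ τ ∈ U, g (3, 0, 0) τ = 0 := hz _ fun h => h3 <| by
    norm_num [frobeniusSolutions] at h
    linarith
  have h21 : ∀ τ ∈ U, g (2, 1, 0) τ = 0 := hz _ fun h => h4 <| by
    norm_num [frobeniusSolutions] at h
    linarith
  have main := fun (τ : ℂ) (hτ : τ ∈ U) => by
    have R := reducedWDVV_of_solvesWDVV hU hg hW h5 hN hτ (hasShape_of_lt h0 h1 hU hz hτ)
    have hG := hasShape_of_lt h0 h1 hU hz hτ 0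
    rw [h30 τ hτ, deriv_eq_zero_on hU h30 τ hτ, h21 τ hτ, deriv_eq_zero_on hU h21 τ hτ] at R
    refine reducedWDVV_generic R ?_ ?_ ?_ ?_ <;> rw [coeff_colPoly hN] <;>
      exact hG.eq_zero _ _ _ (by simp) (by simp) (by simp) (by simp) (by simp) (by simp) (by simp)
        (by simp) (by simp) (by simp) (by simp)
  have hq : ∀ c, ∀ τ ∈ U, g (1, 1, c) τ = 0 := fun c τ hτ => by
    obtain ⟨-, -, -, -, hq, -⟩ := main τ hτ
    have := coeff_colPoly hN 0 τ 1 1 c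
    rw [hq] at this
    exact this.symm
  have hv : ∀ c, ∀ τ ∈ U, g (0, 3, c) τ = 0 := fun c τ hτ => by
    obtain ⟨-, -, -, -, -, hv, -⟩ := main τ hτ
    have := coeff_colPoly hN 0 τ 0 3 c
    rw [hv] at this
    exact this.symm
  simp only [coeff_colPoly hN, Function.iterate_zero, id, Function.iterate_one] at main
  have D := fun α (τ : ℂ) (hτ : τ ∈ U) => hasDerivAt_coeff hU hg α hτ
  have hγ : ∀ τ ∈ U, HasDerivAt (fun τ => -4 * g (1, 2, 1) τ)
      (1 / 2 * (-4 * g (1, 2, 1) τ) ^ 2) τ := fun τ hτ => by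
    refine ((D (1, 2, 1) τ hτ).const_mul (-4)).congr_deriv ?_
    rw [(main τ hτ).2.2.1]; ring
  refine ⟨_, Or.inl fun τ _ => rfl, hγ, fun α => ?_⟩
  by_cases hα : α ∈ frobeniusSolutions σ
  swap
  · exact modularEquation_remainder_of_notMem hU hg hγ hz hα
  have hfirst := fun α => modularEquation_remainder_of_first_order hU hg hγ (α := α)
  rcases frobeniusSolutions_cases h0 h1 hα with
    (rfl | rfl | rfl) | ⟨rfl, h⟩ | ⟨rfl, h⟩ | ⟨c, hc, rfl, -⟩ | ⟨c, hc, rfl, -⟩ | ⟨c, hc, rfl, -⟩ |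
    ⟨c, hc, rfl, -⟩ | ⟨c, hc, rfl, -⟩ | ⟨c, hc, rfl, -⟩
  · refine hfirst _ fun τ hτ => ?_
    obtain ⟨m1, m2, m3, -⟩ := main τ hτ
    norm_num [pivotCoeff_eq, weight]
    linear_combination m2 + m3 + 4 * g (1, 2, 1) τ * m1
  · refine hfirst _ fun τ hτ => ?_
    obtain ⟨-, -, m3, -⟩ := main τ hτ
    norm_num [pivotCoeff_eq, weight]
    linear_combination m3
  · refine hfirst _ fun τ hτ => ?_
    obtain ⟨-, -, -, m4, -⟩ := main τ hτ
    norm_num [pivotCoeff_eq, weight]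
    linear_combination m4
  · exact absurd h h3
  · exact absurd h h4
  · obtain ⟨n, rfl⟩ : ∃ n, c = n + 1 := ⟨c - 1, by omega⟩
    refine hfirst _ fun τ hτ => ?_
    obtain ⟨-, -, -, -, -, -, m, -⟩ := main τ hτ
    norm_num [pivotCoeff_eq, weight]
    linear_combination m n
  · refine hfirst _ fun τ hτ => ?_
    rw [deriv_eq_zero_on hU (hq c) τ hτ, hq c τ hτ]
    norm_num [pivotCoeff_eq]
  · obtain ⟨n, rfl⟩ : ∃ n, c = n + 2 := ⟨c - 2, by omega⟩
    have hn1 : (n : ℂ) + 1 ≠ 0 := Nat.cast_add_one_ne_zero n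
    have hn2 : (n : ℂ) + 2 ≠ 0 := by exact_mod_cast Nat.succ_ne_zero (n + 1)
    -- The forcing term of `z^(n+2)` is the `n`-th coefficient of `4u'² - 2u'p''`, divided by
    -- `(n+1)(n+2)` from the second derivative of `r`.
    refine modularEquation_remainder hU hg hγ (κ := fun τ =>
      (∑ x ∈ Finset.HasAntidiagonal.antidiagonal n,
        (4 * ((x.1 + 1) * (x.2 + 1)) * (g (0, 2, x.1 + 1) τ * g (0, 2, x.2 + 1) τ) -
          2 * ((x.1 + 1) * ((x.2 + 1) * (x.2 + 2))) *
            (g (0, 2, x.1 + 1) τ * g (1, 0, x.2 + 2) τ))) / ((n + 1) * (n + 2))) (fun τ hτ => ?_)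
      fun τ hτ => ?_
    · obtain ⟨-, -, -, -, -, -, -, -, -, m⟩ := main τ hτ
      have e : (4 * Polynomial.derivative (colPoly N g 0 τ 0 2) ^ 2 -
          2 * Polynomial.derivative (colPoly N g 0 τ 0 2) *
            Polynomial.derivative (Polynomial.derivative (colPoly N g 0 τ 1 0))).coeff n =
          ∑ x ∈ Finset.HasAntidiagonal.antidiagonal n,
        (4 * ((x.1 + 1) * (x.2 + 1)) * (g (0, 2, x.1 + 1) τ * g (0, 2, x.2 + 1) τ) -
          2 * ((x.1 + 1) * ((x.2 + 1) * (x.2 + 2))) *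
            (g (0, 2, x.1 + 1) τ * g (1, 0, x.2 + 2) τ)) := by
        rw [sq, mul_assoc, Polynomial.coeff_sub, Polynomial.coeff_ofNat_mul,
          Polynomial.coeff_ofNat_mul, Polynomial.coeff_mul, Polynomial.coeff_mul, Finset.mul_sum,
          Finset.mul_sum, ← Finset.sum_sub_distrib]
        refine Finset.sum_congr rfl fun x _ => ?_
        simp only [Polynomial.coeff_derivative, coeff_colPoly hN, Function.iterate_zero, id]
        push_cast
        ring
      rw [← e, ← m n]
      norm_num [pivotCoeff_eq, weight]
      field_simp
      ring
    · have hu := fun i => (main τ hτ).2.2.2.2.2.2.2.2.1 i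
      have hp := fun i => (main τ hτ).2.2.2.2.2.2.1 i
      refine ((HasDerivAt.fun_sum fun x _ =>
        (((D (0, 2, x.1 + 1) τ hτ).mul (D (0, 2, x.2 + 1) τ hτ)).const_mul _).sub
        (((D (0, 2, x.1 + 1) τ hτ).mul (D (1, 0, x.2 + 2) τ hτ)).const_mul _)).div_const
          _).congr_deriv ?_
      rw [← mul_div_assoc, Finset.mul_sum]
      congr 1
      refine Finset.sum_congr rfl fun x hx => ?_
      -- In each product the two weights are `x.1 + 1` and `x.2 + 1`, with sum `n + 2`: two more
      -- than the weight of `z^(n+2)`.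
      have hx' : (x.1 : ℂ) + x.2 = n := by exact_mod_cast
        Finset.HasAntidiagonal.mem_antidiagonal.mp hx
      rw [hu, hu, hp (x.2 + 1)]
      norm_num [weight]
      rw [← hx']
      ring
  · obtain ⟨n, rfl⟩ : ∃ n, c = n + 1 := ⟨c - 1, by omega⟩
    refine hfirst _ fun τ hτ => ?_
    obtain ⟨-, -, -, -, -, -, -, m, -⟩ := main τ hτ
    norm_num [pivotCoeff_eq, weight]
    linear_combination m n
  · obtain ⟨n, rfl⟩ : ∃ n, c = n + 1 := ⟨c - 1, by omega⟩
    refine hfirst _ fun τ hτ => ?_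
    obtain ⟨-, -, -, -, -, -, -, -, m, -⟩ := main τ hτ
    norm_num [pivotCoeff_eq, weight]
    linear_combination m n
  · refine hfirst _ fun τ hτ => ?_
    rw [deriv_eq_zero_on hU (hv c) τ hτ, hv c τ hτ]
    norm_num [pivotCoeff_eq]

theorem hasPivotTerm (h0 : 0 < σ) (h1 : σ < 1 / 2) : HasPivotTerm σ U g := by
  by_cases h3 : σ = 1 / 3
  · exact hasPivotTerm_third hU hg hz hW h3
  by_cases h4 : σ = 1 / 4
  · exact hasPivotTerm_quarter hU hg hz hW h4
  exact hasPivotTerm_generic hU hg hz hW h0 h1 h3 h4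

end

end

noncomputable section

/-! ### Non-semisimplicity -/

/-- The multiplication of a tangent algebra as a bilinear map. -/
def tangentMulBilin {n : ℕ} (F : (Fin (n + 1) → ℂ) → ℂ) (t : Fin (n + 1) → ℂ) :
    (Fin (n + 1) → ℂ) →ₗ[ℂ] (Fin (n + 1) → ℂ) →ₗ[ℂ] (Fin (n + 1) → ℂ) :=
  LinearMap.mk₂ ℂ (tangentMul F t)
    (fun v v' w => by
      ext k
      simp only [tangentMul, Pi.add_apply, ← Finset.sum_add_distrib]
      exact Finset.sum_congr rfl fun i _ => Finset.sum_congr rfl fun j _ => by ring)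
    (fun c v w => by
      ext k
      simp only [tangentMul, Pi.smul_apply, smul_eq_mul, Finset.mul_sum]
      exact Finset.sum_congr rfl fun i _ => Finset.sum_congr rfl fun j _ => by ring)
    (fun v w w' => by
      ext k
      simp only [tangentMul, Pi.add_apply, ← Finset.sum_add_distrib]
      exact Finset.sum_congr rfl fun i _ => Finset.sum_congr rfl fun j _ => by ring)
    (fun c v w => by
      ext k
      simp only [tangentMul, Pi.smul_apply, smul_eq_mul, Finset.mul_sum]
      exact Finset.sum_congr rfl fun i _ => Finset.sum_congr rfl fun j _ => by ring)

/-- A semisimple tangent algebra has no non-zero element of square zero. -/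
lemma IsSemisimpleAt.eq_zero_of_sq_eq_zero {n : ℕ} {F : (Fin (n + 1) → ℂ) → ℂ}
    {t : Fin (n + 1) → ℂ} (h : IsSemisimpleAt F t) {v : Fin (n + 1) → ℂ}
    (hv : tangentMul F t v v = 0) : v = 0 := by
  obtain ⟨e, he⟩ := h
  have he' : ∀ i j, tangentMulBilin F t (e i) (e j) = if i = j then e i else 0 := he
  have h1 : tangentMulBilin F t v v = 0 := hv
  -- In an idempotent basis the square of `∑ xᵢ eᵢ` is `∑ xᵢ² eᵢ`.
  rw [← e.sum_repr v] at h1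
  simp only [map_sum, LinearMap.sum_apply, map_smul, LinearMap.smul_apply, he', smul_ite,
    smul_zero, Finset.sum_ite_eq', Finset.mem_univ, if_true, smul_smul] at h1
  have h2 := Fintype.linearIndependent_iff.mp e.linearIndependent _ h1
  rw [← e.sum_repr v]
  exact Finset.sum_eq_zero fun i _ => by rw [mul_self_eq_zero.mp (h2 i), zero_smul]

section
variable (i j k n : ℕ) (t : Fin 5 → ℂ) (α : ℕ × ℕ × ℕ)

lemma mul_monoJet_one :
    t 1 * monoJet (i + 1) j k t α = ((α.1 : ℂ) - i) * monoJet i j k t α := by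
  unfold monoJet
  linear_combination (α.2.1.descFactorial j * t 2 ^ (α.2.1 - j)) *
    (α.2.2.descFactorial k * t 3 ^ (α.2.2 - k)) * mul_descFactorial_succ_pow (t 1) α.1 i

lemma mul_monoJet_two :
    t 2 * monoJet i (j + 1) k t α = ((α.2.1 : ℂ) - j) * monoJet i j k t α := by
  unfold monoJet
  linear_combination (α.1.descFactorial i * t 1 ^ (α.1 - i)) *
    (α.2.2.descFactorial k * t 3 ^ (α.2.2 - k)) * mul_descFactorial_succ_pow (t 2) α.2.1 j

lemma mul_monoJet_three :
    t 3 * monoJet i j (k + 1) t α = ((α.2.2 : ℂ) - k) * monoJet i j k t α := by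
  unfold monoJet
  linear_combination (α.1.descFactorial i * t 1 ^ (α.1 - i)) *
    (α.2.1.descFactorial j * t 2 ^ (α.2.1 - j)) * mul_descFactorial_succ_pow (t 3) α.2.2 k

/-- This is the non-cubic contribution of `∂_τ - (c/2)(x∂_x + y∂_y + z∂_z)` inserted twice into a
third-derivative tensor. By Euler's identity, on a monomial of remaining degree `D` the first-order
operator acts as `D` and the second-order one as `D (D - 1)`. -/
lemma jetSum_conformal (S : Finset (ℕ × ℕ × ℕ)) (g : ℕ × ℕ × ℕ → ℂ → ℂ) (c : ℂ) :
    jetSum S g i j k (n + 2) t -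
      c * (t 1 * jetSum S g (i + 1) j k (n + 1) t + t 2 * jetSum S g i (j + 1) k (n + 1) t +
        t 3 * jetSum S g i j (k + 1) (n + 1) t) +
      1 / 4 * c ^ 2 * (t 1 ^ 2 * jetSum S g (i + 1 + 1) j k n t +
        t 2 ^ 2 * jetSum S g i (j + 1 + 1) k n t + t 3 ^ 2 * jetSum S g i j (k + 1 + 1) n t +
        2 * (t 1 * t 2 * jetSum S g (i + 1) (j + 1) k n t +
          t 1 * t 3 * jetSum S g (i + 1) j (k + 1) n t +
          t 2 * t 3 * jetSum S g i (j + 1) (k + 1) n t)) =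
    ∑ α ∈ S, (deriv^[n + 2] (g α) (t 4) -
      c * (weight α + 2 - (i + j + k)) * deriv^[n + 1] (g α) (t 4) +
      1 / 4 * c ^ 2 * ((weight α + 2 - (i + j + k)) * (weight α + 2 - (i + j + k) - 1)) *
        deriv^[n] (g α) (t 4)) * monoJet i j k t α := by
  simp only [jetSum_eq_sum, Finset.mul_sum, ← Finset.sum_add_distrib, ← Finset.sum_sub_distrib]
  refine Finset.sum_congr rfl fun α _ => ?_
  have e1 := mul_monoJet_one i j k t α
  have e2 := mul_monoJet_two i j k t α
  have e3 := mul_monoJet_three i j k t α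
  have e11 := mul_monoJet_one (i + 1) j k t α
  have e22 := mul_monoJet_two i (j + 1) k t α
  have e33 := mul_monoJet_three i j (k + 1) t α
  have e12 := mul_monoJet_one i (j + 1) k t α
  have e13 := mul_monoJet_one i j (k + 1) t α
  have e23 := mul_monoJet_two i j (k + 1) t α
  push_cast at e11 e22 e33
  unfold weight
  linear_combination (-c * deriv^[n + 1] (g α) (t 4)) * (e1 + e2 + e3) +
    (1 / 4 * c ^ 2 * deriv^[n] (g α) (t 4)) * (t 1 * e11 + ((α.1 : ℂ) - i - 1) * e1 +
      t 2 * e22 + ((α.2.1 : ℂ) - j - 1) * e2 + t 3 * e33 + ((α.2.2 : ℂ) - k - 1) * e3 +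
      2 * (t 2 * e12 + ((α.1 : ℂ) - i) * e2 + t 3 * e13 + ((α.1 : ℂ) - i) * e3 +
        t 3 * e23 + ((α.2.1 : ℂ) - j) * e3))

/-- The finset of the three pivot points. -/
def pivotFinset : Finset (ℕ × ℕ × ℕ) := {(2, 0, 2), (1, 2, 1), (0, 4, 0)}

lemma sum_pivotCoeff_mul {S : Finset (ℕ × ℕ × ℕ)} (hS : pivotFinset ⊆ S)
    (f : ℕ × ℕ × ℕ → ℂ) :
    ∑ α ∈ S, pivotCoeff α * f α = 4 * f (2, 0, 2) + 4 * f (1, 2, 1) + f (0, 4, 0) := by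
  rw [← Finset.sum_subset hS]
  · simp [pivotFinset, pivotCoeff_eq]
    ring
  · intro α _ hα
    simp only [pivotFinset, Finset.mem_insert, Finset.mem_singleton, not_or] at hα
    simp [pivotCoeff_eq, hα]

end

/-- All pivot monomials have degree four; this lets one formula treat pivot and non-pivot indices
alike. -/
lemma pivotCoeff_mul_weight (α : ℕ × ℕ × ℕ) : pivotCoeff α * (weight α - 2) = 0 := by
  rw [pivotCoeff_eq]
  by_cases h1 : α = (2, 0, 2)
  · subst h1; norm_num [weight]
  by_cases h2 : α = (1, 2, 1)
  · subst h2; norm_num [weight]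
  by_cases h3 : α = (0, 4, 0)
  · subst h3; norm_num [weight]
  simp [h1, h2, h3]

section
variable {U : Set ℂ} (hU : IsOpen U) {g : (ℕ × ℕ × ℕ) →₀ (ℂ → ℂ)}
  (hg : ∀ α, DifferentiableOn ℂ (g α) U) {γ : ℂ → ℂ}
  (hγ : ∀ τ ∈ U, HasDerivAt γ (1 / 2 * γ τ ^ 2) τ) {α : ℕ × ℕ × ℕ}
  (hM : ModularEquation γ (weight α) (remainder g γ α) U)
include hU hg hγ hM

lemma modularEquation_expand {τ : ℂ} (hτ : τ ∈ U) :
    deriv^[2] (g α) τ + 1 / 32 * pivotCoeff α * γ τ ^ 3 =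
      (weight α + 1) * γ τ * (deriv^[1] (g α) τ + 1 / 32 * pivotCoeff α * γ τ ^ 2) -
        1 / 4 * weight α * (weight α + 1) * γ τ ^ 2 *
          (deriv^[0] (g α) τ + 1 / 16 * pivotCoeff α * γ τ) := by
  have h1 : ∀ τ ∈ U, HasDerivAt (remainder g γ α)
      (deriv^[1] (g α) τ + 1 / 32 * pivotCoeff α * γ τ ^ 2) τ := fun τ hτ =>
    ((hasDerivAt_iterate_deriv hU (hg α) 0 hτ).add
      ((hγ τ hτ).const_mul (1 / 16 * pivotCoeff α))).congr_deriv (by ring)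
  have h2 : HasDerivAt (deriv (remainder g γ α))
      (deriv^[2] (g α) τ + 1 / 32 * pivotCoeff α * γ τ ^ 3) τ := by
    have := (hasDerivAt_iterate_deriv hU (hg α) 1 hτ).add
      (((hγ τ hτ).pow 2).const_mul (1 / 32 * pivotCoeff α))
    refine (this.congr_deriv ?_).congr_of_eventuallyEq
      (Filter.eventuallyEq_of_mem (hU.mem_nhds hτ) fun x hx => (h1 x hx).deriv)
    simp only [Nat.cast_ofNat, Nat.reduceAdd, Nat.reduceSub, pow_one]
    ring
  have h := hM τ hτ
  rw [h2.deriv, (h1 τ hτ).deriv] at h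
  exact h

/-- At weight 2 the pivot contributions to the modular equation add up as `1/32 - 3/32 + 3/32`,
which leaves the source term on the right. -/
lemma modularEquation_bracket {τ : ℂ} (hτ : τ ∈ U) :
    deriv^[2] (g α) τ - γ τ * (weight α + 1) * deriv^[1] (g α) τ +
      1 / 4 * γ τ ^ 2 * ((weight α + 1) * weight α) * deriv^[0] (g α) τ =
      -1 / 32 * pivotCoeff α * γ τ ^ 3 := by
  linear_combination modularEquation_expand hU hg hγ hM hτ -
    1 / 64 * γ τ ^ 3 * (weight α + 1) * pivotCoeff_mul_weight α

/-- Differentiate `modularEquation_bracket` and subtract `γ` times it: the undifferentiated term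
cancels and the factors shift by one. -/
lemma modularEquation_bracket_deriv {τ : ℂ} (hτ : τ ∈ U) :
    deriv^[3] (g α) τ - γ τ * (weight α + 2) * deriv^[2] (g α) τ +
      1 / 4 * γ τ ^ 2 * ((weight α + 2) * (weight α + 1)) * deriv^[1] (g α) τ =
      -1 / 64 * pivotCoeff α * γ τ ^ 4 := by
  have D := fun n => hasDerivAt_iterate_deriv hU (hg α) n hτ
  have h1 : HasDerivAt (fun τ => deriv^[2] (g α) τ - γ τ * (weight α + 1) * deriv^[1] (g α) τ +
      1 / 4 * γ τ ^ 2 * ((weight α + 1) * weight α) * deriv^[0] (g α) τ) _ τ :=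
    ((D 2).sub (((hγ τ hτ).mul_const _).mul (D 1))).add
      (((((hγ τ hτ).pow 2).const_mul (1 / 4)).mul_const _).mul (D 0))
  have h2 : HasDerivAt (fun τ => deriv^[2] (g α) τ - γ τ * (weight α + 1) * deriv^[1] (g α) τ +
      1 / 4 * γ τ ^ 2 * ((weight α + 1) * weight α) * deriv^[0] (g α) τ)
      (-1 / 64 * 3 * pivotCoeff α * γ τ ^ 4) τ := by
    refine ((((hγ τ hτ).pow 3).const_mul (-1 / 32 * pivotCoeff α)).congr_deriv ?_
      ).congr_of_eventuallyEq (Filter.eventuallyEq_of_mem (hU.mem_nhds hτ) fun x hx =>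
        modularEquation_bracket hU hg hγ hM hx)
    simp only [Nat.cast_ofNat, Nat.reduceSub]
    ring
  have h3 := h1.unique h2
  simp only [Pi.pow_apply, zero_add, Nat.reduceAdd, Nat.cast_ofNat, Nat.reduceSub, pow_one] at h3
  linear_combination h3 - γ τ * modularEquation_bracket hU hg hγ hM hτ

end

section
variable {U : Set ℂ} (hU : IsOpen U) {g : (ℕ × ℕ × ℕ) →₀ (ℂ → ℂ)}
  (hg : ∀ α, DifferentiableOn ℂ (g α) U) {γ : ℂ → ℂ}
  (hγ : ∀ τ ∈ U, HasDerivAt γ (1 / 2 * γ τ ^ 2) τ)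
  (hM : ∀ α, ModularEquation γ (weight α) (remainder g γ α) U) {t : Fin 5 → ℂ}
  (ht : t ∈ regionOver U)
include hU hg hγ hM ht

lemma jetSum_conformal_first {S : Finset (ℕ × ℕ × ℕ)} (hS : pivotFinset ⊆ S) {i j k : ℕ}
    (h : i + j + k = 1) :
    jetSum S g i j k 2 t -
      γ (t 4) * (t 1 * jetSum S g (i + 1) j k 1 t + t 2 * jetSum S g i (j + 1) k 1 t +
        t 3 * jetSum S g i j (k + 1) 1 t) +
      1 / 4 * γ (t 4) ^ 2 * (t 1 ^ 2 * jetSum S g (i + 1 + 1) j k 0 t +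
        t 2 ^ 2 * jetSum S g i (j + 1 + 1) k 0 t + t 3 ^ 2 * jetSum S g i j (k + 1 + 1) 0 t +
        2 * (t 1 * t 2 * jetSum S g (i + 1) (j + 1) k 0 t +
          t 1 * t 3 * jetSum S g (i + 1) j (k + 1) 0 t +
          t 2 * t 3 * jetSum S g i (j + 1) (k + 1) 0 t)) =
    -1 / 32 * γ (t 4) ^ 3 * (4 * monoJet i j k t (2, 0, 2) + 4 * monoJet i j k t (1, 2, 1) +
      monoJet i j k t (0, 4, 0)) := by
  have h' : (i : ℂ) + j + k = 1 := by exact_mod_cast h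
  rw [jetSum_conformal i j k 0 t S g (γ (t 4)), ← sum_pivotCoeff_mul hS, Finset.mul_sum, h']
  refine Finset.sum_congr rfl fun α _ => ?_
  linear_combination monoJet i j k t α * modularEquation_bracket hU hg hγ (hM α) ht

lemma jetSum_conformal_last {S : Finset (ℕ × ℕ × ℕ)} (hS : pivotFinset ⊆ S) :
    jetSum S g 0 0 0 3 t -
      γ (t 4) * (t 1 * jetSum S g 1 0 0 2 t + t 2 * jetSum S g 0 1 0 2 t +
        t 3 * jetSum S g 0 0 1 2 t) +
      1 / 4 * γ (t 4) ^ 2 * (t 1 ^ 2 * jetSum S g 2 0 0 1 t +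
        t 2 ^ 2 * jetSum S g 0 2 0 1 t + t 3 ^ 2 * jetSum S g 0 0 2 1 t +
        2 * (t 1 * t 2 * jetSum S g 1 1 0 1 t +
          t 1 * t 3 * jetSum S g 1 0 1 1 t +
          t 2 * t 3 * jetSum S g 0 1 1 1 t)) =
    -1 / 64 * γ (t 4) ^ 4 * (4 * monoJet 0 0 0 t (2, 0, 2) + 4 * monoJet 0 0 0 t (1, 2, 1) +
      monoJet 0 0 0 t (0, 4, 0)) := by
  have e := jetSum_conformal 0 0 0 1 t S g (γ (t 4))
  simp only [zero_add, Nat.reduceAdd] at e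
  rw [e, ← sum_pivotCoeff_mul hS, Finset.mul_sum]
  refine Finset.sum_congr rfl fun α _ => ?_
  push_cast
  linear_combination monoJet 0 0 0 t α * modularEquation_bracket_deriv hU hg hγ (hM α) ht

/-- In each lowered component of the square, the source terms from the pivot points cancel the
contribution of the cubic part. -/
theorem not_isSemisimpleAt_of_modularEquation : ¬ IsSemisimpleAt (prepotential g) t := by
  intro hss
  -- The pivot points are added because the source terms involve `γ` there, even where `g` has no
  -- support.
  set S := g.support ∪ pivotFinset with hSdef
  have hS : g.support ⊆ S := Finset.subset_union_left
  have hP : pivotFinset ⊆ S := Finset.subset_union_right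
  have hv := hss.eq_zero_of_sq_eq_zero (v := ![-1 / 4 * γ (t 4) ^ 2 * (t 1 * t 3 + 1 / 2 * t 2 ^ 2),
    -1 / 2 * γ (t 4) * t 1, -1 / 2 * γ (t 4) * t 2, -1 / 2 * γ (t 4) * t 3, 1]) ?_
  · have := congrFun hv 4
    simp at this
  have A := @jetSum_conformal_first U hU g hg γ hγ hM t ht S hP
  have e0 := jetSum_conformal_last hU hg hγ hM ht hP
  have e1 := @A 1 0 0 rfl
  have e2 := @A 0 1 0 rfl
  have e3 := @A 0 0 1 rfl
  simp only [monoJet] at e0 e1 e2 e3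
  norm_num [Nat.descFactorial] at e0 e1 e2 e3
  ext k
  rw [tangentMul_prepotential hU hS hg ht]
  fin_cases k
  · simp [Fin.sum_univ_five, cLow_prepotential hU hS hg ht, jet, cubicThird, Fin.rev,
      Pi.single_apply]
    linear_combination e0
  · simp [Fin.sum_univ_five, cLow_prepotential hU hS hg ht, jet, cubicThird, Fin.rev,
      Pi.single_apply]
    linear_combination e3
  · simp [Fin.sum_univ_five, cLow_prepotential hU hS hg ht, jet, cubicThird, Fin.rev,
      Pi.single_apply]
    linear_combination e2
  · simp [Fin.sum_univ_five, cLow_prepotential hU hS hg ht, jet, cubicThird, Fin.rev,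
      Pi.single_apply]
    linear_combination e1
  -- This component is the metric norm `2 v₁ v₅ + 2 v₂ v₄ + v₃²` of the vector; its first entry is
  -- chosen to make it zero.
  · simp [Fin.sum_univ_five, cLow_prepotential hU hS hg ht, jet, cubicThird, Fin.rev,
      Pi.single_apply]
    ring

end

end

/-! ### From the modular equation to Euler equations, and the main theorem -/

noncomputable section

lemma ModularEquation.eulerEquation {γ h : ℂ → ℂ} {w c : ℂ} {U : Set ℂ}
    (hM : ModularEquation γ w h U) (hc : c ∉ U) (hγ : ∀ τ ∈ U, γ τ = -2 / (τ - c)) :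
    EulerEquation c (2 * (w + 1)) (w * (w + 1)) h U := by
  intro τ hτ
  have hne : τ - c ≠ 0 := sub_ne_zero.mpr fun e => hc (e ▸ hτ)
  rw [hM τ hτ, hγ τ hτ]
  field_simp
  ring

end

theorem mainTheorem9 :
    -- the three pivot points, and the table of non-pivot solutions
    (pivotPoints = {(2, 0, 2), (1, 2, 1), (0, 4, 0)}) ∧
    (∀ σ : ℝ, 0 < σ → σ ≤ 1 / 2 → frobeniusSolutions σ \ pivotPoints = tableRows σ) ∧
    -- the reduction of the WDVV equations
    (∀ σ : ℝ, 0 < σ → σ ≤ 1 / 2 →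
      ∀ U : Set ℂ, IsOpen U → IsConnected U →
      ∀ g : (ℕ × ℕ × ℕ) →₀ (ℂ → ℂ), (∀ α, DifferentiableOn ℂ (g α) U) →
      (∀ t ∈ regionOver U, eulerDeriv σ (prepotential g) t = 2 * prepotential g t) →
      SolvesWDVV (prepotential g) (regionOver U) →
      -- only the monomials of the pivot points and of the table occur
      (∀ α, α ∉ pivotPoints ∪ tableRows σ → ∀ τ ∈ U, g α τ = 0) ∧
      -- the Riccati equation for a pivot term, and Euler equations for all the other terms
      (σ ≠ 1 / 2 → ∃ γ : ℂ → ℂ,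
        ((∀ τ ∈ U, γ τ = -4 * g (1, 2, 1) τ) ∨
          (σ = 1 / 4 ∧ ∀ τ ∈ U, γ τ = 4 * g (1, 2, 1) τ - 8 * g (2, 0, 2) τ)) ∧
        (∀ τ ∈ U, HasDerivAt γ (1 / 2 * γ τ ^ 2) τ) ∧
        (((∀ τ ∈ U, γ τ = 0) ∧
            ∀ α, ∀ τ ∈ U, deriv (deriv (remainder g γ α)) τ = 0) ∨
          (∃ c : ℂ, c ∉ U ∧ (∀ τ ∈ U, γ τ = -2 / (τ - c)) ∧
            ∀ α, EulerEquation c (2 * (weight α + 1)) (weight α * (weight α + 1))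
              (remainder g γ α) U))) ∧
      -- non-semisimplicity
      (σ ≠ 1 / 2 → ∀ t ∈ regionOver U, ¬ IsSemisimpleAt (prepotential g) t) ∧
      ((∃ t ∈ regionOver U, IsSemisimpleAt (prepotential g) t) → σ = 1 / 2)) := by
  refine ⟨pivotPoints_eq, fun σ h0 h1 => frobeniusSolutions_diff_pivotPoints h0 h1,
    fun σ h0 h1 U hU hc g hg hE hW => ?_⟩
  have hz : ∀ α, α ∉ frobeniusSolutions σ → ∀ τ ∈ U, g α τ = 0 := fun α hα τ hτ =>
    eq_zero_of_notMem_frobeniusSolutions hU hg hE hα hτ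
  have hpivot : σ ≠ 1 / 2 → HasPivotTerm σ U g := fun h =>
    hasPivotTerm hU hg hz hW h0 (lt_of_le_of_ne h1 h)
  have hss : σ ≠ 1 / 2 → ∀ t ∈ regionOver U, ¬ IsSemisimpleAt (prepotential g) t := by
    intro h t ht
    obtain ⟨γ, -, hγ, hM⟩ := hpivot h
    exact not_isSemisimpleAt_of_modularEquation hU hg hγ hM ht
  refine ⟨fun α hα => hz α fun hs => hα ?_, fun h => ?_, hss, ?_⟩
  · rw [← frobeniusSolutions_diff_pivotPoints h0 h1, Set.union_sdiff_self]
    exact Or.inr hs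
  · obtain ⟨γ, hform, hγ, hM⟩ := hpivot h
    refine ⟨γ, hform, hγ, (riccati_cases hU hc hγ).imp (fun h => ⟨h, fun α τ hτ => ?_⟩) ?_⟩
    · rw [hM α τ hτ, h τ hτ]
      ring
    · rintro ⟨c, hcU, h⟩
      exact ⟨c, hcU, h, fun α => (hM α).eulerEquation hcU h⟩
  · rintro ⟨t, ht, h⟩
    by_contra hσ
    exact hss hσ t ht h
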